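/- For an integer $c\ge 0$ let $cK_3$ denote the multigraph on three vertices in which every two vertices are joined by exactly $c$ parallel edges, and let $cK_3+e$ denote the multigraph obtained from $cK_3$ by adding one new edge between one pair of vertices. A multigraph is $k$-edge-colorable if its edges can be assigned $k$ colors so that any two distinct edges with a common endpoint receive different colors. All multigraphs are finite and loopless. Let $\Delta\ge 4$ and let $G=(V,E)$ be a multigraph of maximum degree $\Delta$. Then $G$ has a $\Delta$-edge-colorable subgraph with at least $$\frac{\Delta}{\lfloor \frac32\Delta\rfloor-1}\,|E|$$ edges, unless $\Delta$ is even and $G$ contains $\frac{\Delta}{2}K_3$ as a subgraph, or $\Delta$ is odd and $G$ contains $\frac{\Delta-1}{2}K_3+e$ as a subgraph. Moreover, such a subgraph and its $\Delta$-edge-coloring can be found in polynomial time, for every fixed $\Delta$: there is one algorithm and, for every $\Delta\ge4$, a polynomial $p_\Delta$ such that, given any multigraph $G$ with $n$ vertices, $m$ edges and maximum degree $\Delta$ that is not one of the exceptions above, the algorithm outputs, within $p_\Delta(n+m)$ steps, a set of at least $\frac{\Delta}{\lfloor \frac32\Delta\rfloor-1}\,m$ edges together with a proper coloring of these edges with $\Delta$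 colors. -/

import Mathlib

open scoped Graph

namespace MaxECS

/-! ### Multigraphs

Multigraphs are Mathlib's `Graph α β`. All multigraphs below are finite and loopless. -/

/-- The multigraph with vertex set `α` and edge set `β` in which the edge `e` joins the two members
of the unordered pair `ends e`. -/
def ofEnds {α β : Type*} (ends : β → Sym2 α) : Graph α β where
  vertexSet := Set.univ
  edgeSet := Set.univ
  IsLink e x y := ends e = s(x, y)
  isLink_symm _ _ := ⟨fun _ _ h => h.trans Sym2.eq_swap⟩
  eq_or_eq_of_isLink_of_isLink e x y v w h h' := by
    rw [h, Sym2.eq_iff] at h'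
    rcases h' with h' | h'
    · exact Or.inl h'.1
    · exact Or.inr h'.1
  edge_mem_iff_exists_isLink e := by
    simp only [Set.mem_univ, true_iff]
    induction h : ends e with
    | _ x y => exact ⟨x, y, rfl⟩
  left_mem_of_isLink _ _ _ _ := Set.mem_univ _

/-- The degree of a vertex of a loopless multigraph: the number of edges incident with it. -/
noncomputable def degree {α β : Type*} (G : Graph α β) (v : α) : ℕ :=
  (G.incidenceSet v).ncard

/-- `Δ` is the maximum degree of `G`. -/
def HasMaxDegree {α β : Type*} (G : Graph α β) (Δ : ℕ) : Prop :=
  IsGreatest (degree G '' V(G)) Δ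

/-- `G` is `k`-edge-colorable: its edges can be given `k` colors such that any two distinct edges
with a common end receive different colors. -/
def EdgeColorable {α β : Type*} (G : Graph α β) (k : ℕ) : Prop :=
  ∃ c : E(G) → Fin k, ∀ (e f : E(G)) (v : α), e ≠ f → G.Inc e v → G.Inc f v → c e ≠ c f

/-- A partial `k`-edge-coloring: an edge `e` with `π e = none` is uncolored, and any two distinct
colored edges with a common end have different colors. -/
def IsPartialColoring {α β : Type*} (G : Graph α β) {k : ℕ} (π : β → Option (Fin k)) : Prop :=
  ∀ (e f : β) (v : α), e ≠ f → G.Inc e v → G.Inc f v → π e ≠ none → π e ≠ π f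

/-- `G` contains a copy of `K` as a (not necessarily induced) subgraph. -/
def Contains {α β α' β' : Type*} (G : Graph α β) (K : Graph α' β') : Prop :=
  ∃ (f : V(K) ↪ V(G)) (g : E(K) ↪ E(G)), ∀ (e : E(K)) (x y : V(K)),
    K.IsLink e x y → G.IsLink (g e : β) (f x : α) (f y : α)

/-- `cK₃`: three vertices, and `c` parallel edges between every two of them. The edge `(i, j)` is
the `j`-th edge between the vertices `i` and `i + 1` modulo `3`. -/
def multiTriangle (c : ℕ) : Graph (Fin 3) (Fin 3 × Fin c) :=
  ofEnds fun e => s(e.1, e.1 + 1)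

/-- `cK₃ + e`: the multigraph `cK₃` with one more edge, `none`, between the vertices `0`, `1`. -/
def multiTrianglePlus (c : ℕ) : Graph (Fin 3) (Option (Fin 3 × Fin c)) :=
  ofEnds fun e => e.elim s(0, 1) fun e => s(e.1, e.1 + 1)

/-- `Δ` is even and `G` contains `(Δ/2)K₃`, or `Δ` is odd and `G` contains `((Δ-1)/2)K₃ + e`. -/
def HasBottleneck {α β : Type*} (G : Graph α β) (Δ : ℕ) : Prop :=
  (Even Δ ∧ Contains G (multiTriangle (Δ / 2))) ∨
    (Odd Δ ∧ Contains G (multiTrianglePlus ((Δ - 1) / 2)))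

/-- The fraction `Δ / (⌊3Δ/2⌋ - 1)`. -/
def ratio (Δ : ℕ) : ℚ := (Δ : ℚ) / ((⌊(3 / 2 : ℚ) * Δ⌋ : ℚ) - 1)

/-! ### The machine model

Programs of a first-order Lisp-like language (a point-free version of Jones' WHILE language) over
binary trees built from `nil` by `cons`. Each program acts on one tree. Every elementary operation
(reading one component of a pair, making one new pair, one test for `nil`, one passage through a
control construct) costs one unit of time. Trees are handled by reference and the only test is
whether the root is `nil`, so each unit of time is a bounded number of pointer operations. A
computation of `t` steps is therefore simulated by a Turing machine in time polynomial in `t`, the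
input size and the size of the output that is written out; conversely, a Turing machine is
simulated with constant-factor overhead. For outputs of polynomial size, polynomial time in
this model is thus the usual polynomial time. -/

/-- The data: binary trees. -/
inductive Val : Type
  | nil : Val
  | cons : Val → Val → Val

/-- The programs. -/
inductive Prog : Type
  /-- return the constant `nil` -/
  | nil : Prog
  /-- return the input -/
  | id : Prog
  /-- return the first component of the input (`nil` for the input `nil`) -/
  | fst : Prog
  /-- return the second component of the input (`nil` for the input `nil`) -/
  | snd : Prog
  /-- `pair p q` runs `p` and `q` on the input and returns the pair of the results -/
  | pair : Prog → Prog → Prog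
  /-- `seq p q` runs `p` on the input and then `q` on the result -/
  | seq : Prog → Prog → Prog
  /-- `ite b p q` runs `b` on the input, and then, on the same input, `p` if the result was not
  `nil`, and `q` if it was `nil` -/
  | ite : Prog → Prog → Prog → Prog
  /-- `loop b p`: while the result of `b` on the current value is not `nil`, replace the current
  value by the result of `p` on it; return the final value -/
  | loop : Prog → Prog → Prog

/-- `Run p x y t`: the program `p`, started on the input `x`, halts after exactly `t` steps with
the output `y`. -/
inductive Run : Prog → Val → Val → ℕ → Prop
  | nil (x : Val) : Run .nil x .nil 1
  | id (x : Val) : Run .id x x 1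
  | fst_nil : Run .fst .nil .nil 1
  | fst_cons (x y : Val) : Run .fst (.cons x y) x 1
  | snd_nil : Run .snd .nil .nil 1
  | snd_cons (x y : Val) : Run .snd (.cons x y) y 1
  | pair {p q : Prog} {x y z : Val} {s t : ℕ} :
      Run p x y s → Run q x z t → Run (.pair p q) x (.cons y z) (s + t + 1)
  | seq {p q : Prog} {x y z : Val} {s t : ℕ} :
      Run p x y s → Run q y z t → Run (.seq p q) x z (s + t + 1)
  | ite_true {b p q : Prog} {x u v y : Val} {s t : ℕ} :
      Run b x (.cons u v) s → Run p x y t → Run (.ite b p q) x y (s + t + 1)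
  | ite_false {b p q : Prog} {x y : Val} {s t : ℕ} :
      Run b x .nil s → Run q x y t → Run (.ite b p q) x y (s + t + 1)
  | loop_done {b p : Prog} {x : Val} {s : ℕ} :
      Run b x .nil s → Run (.loop b p) x x (s + 1)
  | loop_step {b p : Prog} {x u v y z : Val} {r s t : ℕ} :
      Run b x (.cons u v) r → Run p x y s → Run (.loop b p) y z t →
        Run (.loop b p) x z (r + s + t + 1)

/-! ### Input and output formats -/

/-- Natural numbers, in unary. -/
def encodeNat : ℕ → Val
  | 0 => .nil
  | k + 1 => .cons .nil (encodeNat k)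

/-- Lists, as right-nested pairs ending in `nil`. -/
def encodeList : List Val → Val
  | [] => .nil
  | x :: l => .cons x (encodeList l)

/-- The input: the number `n` of vertices, and the list of the `m` edges, each as the pair of the
numbers of its two ends. -/
def encodeInput {n m : ℕ} (ends : Fin m → Fin n × Fin n) : Val :=
  .cons (encodeNat n) <| encodeList <| List.ofFn fun e =>
    .cons (encodeNat (ends e).1) (encodeNat (ends e).2)

/-- The output: for each of the `m` edges, in their input order, `0` if the edge is uncolored and
`c + 1` if it has the color `c ∈ {0, …, k - 1}`. -/
def encodeOutput {m k : ℕ} (π : Fin m → Option (Fin k)) : Val :=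
  encodeList <| List.ofFn fun e => encodeNat ((π e).elim 0 fun c => (c : ℕ) + 1)

/-- The multigraph with vertices `0, …, n - 1` and edges `0, …, m - 1` given by the list of the
ends of its edges. -/
def inputGraph {n m : ℕ} (ends : Fin m → Fin n × Fin n) : Graph (Fin n) (Fin m) :=
  ofEnds fun e => s((ends e).1, (ends e).2)

end MaxECS

/-! Write Δ = 2d + ε with ε ∈ {0, 1}, and let k = ⌊3Δ/2⌋ - 1 = 3d + ε - 1, one less than Shannon's
bound. The core is that a multigraph without the exceptional triangle is k-edge-colorable. Arrange
the k colour classes cyclically: each edge lies in exactly Δ of the k windows of Δ consecutive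
classes, so some window contains at least Δ/k of all edges (`exists_window`).

The k-colouring comes from local search. A move recolours one edge or exchanges two colours on a
Kempe chain. If xy is uncoloured and no proper colouring within fourteen moves has fewer uncoloured
edges, then there is a fat triangle (`State.fatTriangle`). The tool throughout is that a Kempe chain
is a path or a cycle, so it cannot contain three vertices each missing one of its two colours
(`three_ends`).

By degrees, every vertex misses at least d - 1 colours, and x and y miss at least d. Call yz a fan
edge if its colour is missing at x. The missing sets of x, y and the fan vertices are pairwise
disjoint. Two different fan vertices z, z' would make four disjoint sets with at least 4d - 2 ≥ k
colours, hence all of them; but an edge from z leads to a fifth vertex w, and the Kierstead path x,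
y, z, w prevents w from missing any colour of the four sets (`State.fan_unique`). In a similar way
the fan edges at x lead to the same z (`State.fan_eq_opposite`), and the edges at y in colours
missing at z lead to x (`State.second_fan`). Therefore x, y, z are pairwise joined by at least d
edges. For even Δ this is the exception. For odd Δ, if no pair has d + 1 edges, some colour ω is
missing at none of x, y, z and occurs on no edge of the triangle, so its edges at x and y leave the
triangle; `State.leaving_absurd` then produces a chain with three ends.

For the running time, polynomial-time functions are closed under composition and under folds whose
accumulators stay polynomially bounded (`PT.foldl`). The search depth is an absolute constant and
each round lowers the number of uncoloured edges, so m rounds suffice. The same algorithm, proved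
correct, also yields the existence statement. -/

namespace MaxECS

/-! ### Kempe chains -/

/-- In a graph of maximum degree at most two, three distinct vertices of degree at most one do not
all lie in one component. -/
theorem not_three_reachable {V : Type*} [Finite V] (G : SimpleGraph V)
    (h2 : ∀ v, (G.neighborSet v).ncard ≤ 2) {x y z : V} (hxy : x ≠ y) (hxz : x ≠ z) (hyz : y ≠ z)
    (hx : (G.neighborSet x).ncard ≤ 1) (hy : (G.neighborSet y).ncard ≤ 1)
    (hz : (G.neighborSet z).ncard ≤ 1) (rxy : G.Reachable x y) (rxz : G.Reachable x z) : False := by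
  classical
  have := Fintype.ofFinite V
  set C := G.connectedComponentMk x with hC
  have mx : x ∈ C.supp := rfl
  have my : y ∈ C.supp := (SimpleGraph.ConnectedComponent.eq.2 rxy).symm
  have mz : z ∈ C.supp := (SimpleGraph.ConnectedComponent.eq.2 rxz).symm
  have hconn : (G.induce C.supp).Connected := C.connected_toSimpleGraph
  set H := G.induce C.supp with hH
  have hcard := hconn.card_vert_le_card_edgeSet_add_one
  have hsum := H.sum_degrees_eq_twice_card_edges
  have hdeg : ∀ v : C.supp, H.degree v ≤ (G.neighborSet v).ncard := by
    intro v
    rw [← SimpleGraph.card_neighborFinset_eq_degree, ← Set.ncard_coe_finset,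
      ← Set.ncard_image_of_injective _ Subtype.val_injective]
    refine Set.ncard_le_ncard ?_ (Set.toFinite _)
    rintro _ ⟨w, hw, rfl⟩
    simpa [hH] using hw
  let T : Finset C.supp := {⟨x, mx⟩, ⟨y, my⟩, ⟨z, mz⟩}
  have hT : T.card = 3 := by
    rw [Finset.card_eq_three]
    exact ⟨_, _, _, by simpa using hxy, by simpa using hxz, by simpa using hyz, rfl⟩
  -- The degree sum in the component C is at most 2|C| - 3, while connectedness gives at least |C| -
  -- 1 edges, that is, degree sum at least 2|C| - 2.
  have hb : ∑ v, H.degree v + T.card ≤ ∑ v : C.supp, 2 := by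
    rw [← Finset.sum_sdiff (Finset.subset_univ T), ← Finset.sum_sdiff (Finset.subset_univ T)]
    have h1 : ∑ v ∈ Finset.univ \ T, H.degree v ≤ ∑ v ∈ Finset.univ \ T, 2 :=
      Finset.sum_le_sum fun v _ => (hdeg v).trans (h2 _)
    have h3 : ∑ v ∈ T, H.degree v ≤ ∑ v ∈ T, 1 := by
      refine Finset.sum_le_sum fun v hv => (hdeg v).trans ?_
      simp only [T, Finset.mem_insert, Finset.mem_singleton] at hv
      rcases hv with rfl | rfl | rfl <;> assumption
    simp only [Finset.sum_const, smul_eq_mul, mul_one] at h1 h3 ⊢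
    omega
  have he : Nat.card H.edgeSet = H.edgeFinset.card := by
    rw [Nat.card_eq_fintype_card, SimpleGraph.edgeFinset_card]
  rw [he, Nat.card_eq_fintype_card] at hcard
  simp only [Finset.sum_const, smul_eq_mul, Finset.card_univ] at hb
  omega

/-! ### Missing colours and exchanges on Kempe chains -/

section Coloring

variable {V E : Type*} {ends : E → Sym2 V} {k : ℕ} {φ : E → ℕ}

/-- Colour `c` is missing at the vertex `v`. -/
def Misses (ends : E → Sym2 V) (φ : E → ℕ) (c : ℕ) (v : V) : Prop :=
  ∀ e, v ∈ ends e → φ e ≠ c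

open Classical in
/-- The set of the colours in `{1, …, k}` that are missing at `v`. -/
noncomputable def missing (ends : E → Sym2 V) (k : ℕ) (φ : E → ℕ) (v : V) : Finset ℕ :=
  (Finset.Icc 1 k).filter fun c => Misses ends φ c v

/-- Distinct edges with a common end and nonzero colours have different colours. -/
def Proper (ends : E → Sym2 V) (φ : E → ℕ) : Prop :=
  ∀ e f v, e ≠ f → v ∈ ends e → v ∈ ends f → φ e ≠ 0 → φ e ≠ φ f

/-- The simple graph underlying the subgraph of the edges coloured `a` or `b`. -/
def kempe (ends : E → Sym2 V) (φ : E → ℕ) (a b : ℕ) : SimpleGraph V where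
  Adj u v := u ≠ v ∧ ∃ e, ends e = s(u, v) ∧ (φ e = a ∨ φ e = b)
  symm := ⟨fun _ _ ⟨h, e, he, hc⟩ => ⟨h.symm, e, he.trans Sym2.eq_swap, hc⟩⟩
  loopless := ⟨fun _ h => h.1 rfl⟩

open Classical in
/-- Exchange the colours `a` and `b` on the component of the vertex `v`. -/
noncomputable def kempeSwap (ends : E → Sym2 V) (φ : E → ℕ) (v : V) (a b : ℕ) (e : E) : ℕ :=
  if ∃ u ∈ ends e, (kempe ends φ a b).Reachable v u then Equiv.swap a b (φ e) else φ e

theorem mem_missing {v : V} {c : ℕ} :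
    c ∈ missing ends k φ v ↔ (1 ≤ c ∧ c ≤ k) ∧ Misses ends φ c v := by
  simp [missing]

theorem missing_pos {v : V} {c : ℕ} (h : c ∈ missing ends k φ v) : c ≠ 0 := by
  have := (mem_missing.1 h).1.1
  omega

theorem color_ne_of_missing {v : V} {c : ℕ} (h : c ∈ missing ends k φ v) {e : E} (he : v ∈ ends e) :
    φ e ≠ c := (mem_missing.1 h).2 e he

theorem exists_edge_of_not_missing {v : V} {c : ℕ} (h1 : 1 ≤ c) (hk : c ≤ k)
    (h : c ∉ missing ends k φ v) : ∃ e w, ends e = s(v, w) ∧ φ e = c := by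
  have : ¬ Misses ends φ c v := fun h' => h (mem_missing.2 ⟨⟨h1, hk⟩, h'⟩)
  simp only [Misses, not_forall, not_not] at this
  obtain ⟨e, he, hc⟩ := this
  obtain ⟨w, hw⟩ := he
  exact ⟨e, w, hw, hc⟩

theorem kempe_comm (a b : ℕ) : kempe ends φ a b = kempe ends φ b a := by
  ext u v
  simp only [kempe, or_comm]

theorem Proper.eq (hp : Proper ends φ) {e f : E} {v : V} (he : v ∈ ends e) (hf : v ∈ ends f)
    (h0 : φ e ≠ 0) (h : φ e = φ f) : e = f := by
  by_contra hne
  exact hp e f v hne he hf h0 h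

theorem Proper.end_eq (hp : Proper ends φ) {e f : E} {v w w' : V} (he : ends e = s(v, w))
    (hf : ends f = s(v, w')) (h0 : φ e ≠ 0) (h : φ e = φ f) : w = w' := by
  have := hp.eq (v := v) (by simp [he]) (by simp [hf]) h0 h
  subst this
  rw [he] at hf
  exact Sym2.congr_right.1 hf

/-- Properness makes the neighbours of `v` in the chain inject into the colours available at `v`:
two in general, one if `a` or `b` is missing. Zero is excluded because `Proper` does not restrict
uncoloured edges. -/
theorem ncard_kempe_le (hp : Proper ends φ) {a b : ℕ} (S : Finset ℕ) (v : V) (ha : a ≠ 0)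
    (hb : b ≠ 0) (hS : ∀ e, v ∈ ends e → (φ e = a ∨ φ e = b) → φ e ∈ S) :
    ((kempe ends φ a b).neighborSet v).ncard ≤ S.card := by
  classical
  have hex : ∀ w : V, w ∈ (kempe ends φ a b).neighborSet v →
      ∃ e, ends e = s(v, w) ∧ (φ e = a ∨ φ e = b) := fun w hw => hw.2
  choose g hg1 hg2 using hex
  rw [← Set.ncard_coe_finset]
  refine Set.ncard_le_ncard_of_injOn (fun w => if h : _ then φ (g w h) else 0) ?_ ?_
    (Finset.finite_toSet _)
  · intro w hw
    simp only [dif_pos hw]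
    exact hS _ (by simp [hg1 w hw]) (hg2 w hw)
  · intro w hw w' hw' h
    simp only [dif_pos hw, dif_pos hw'] at h
    refine hp.end_eq (hg1 w hw) (hg1 w' hw') ?_ h
    rcases hg2 w hw with h | h <;> rw [h] <;> assumption

/-- Three distinct vertices each missing one of two colours are not in one Kempe chain. -/
theorem three_ends [Finite V] (hp : Proper ends φ) {a b : ℕ} (ha : a ≠ 0) (hb : b ≠ 0)
    {x y z : V} (hxy : x ≠ y) (hxz : x ≠ z) (hyz : y ≠ z)
    (hx : Misses ends φ a x ∨ Misses ends φ b x) (hy : Misses ends φ a y ∨ Misses ends φ b y)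
    (hz : Misses ends φ a z ∨ Misses ends φ b z) (rxy : (kempe ends φ a b).Reachable x y)
    (rxz : (kempe ends φ a b).Reachable x z) : False := by
  have key : ∀ v, Misses ends φ a v ∨ Misses ends φ b v →
      ((kempe ends φ a b).neighborSet v).ncard ≤ 1 := by
    rintro v (h | h)
    · exact ncard_kempe_le hp {b} v ha hb fun e he hc => by
        simpa using hc.resolve_left (h e he)
    · exact ncard_kempe_le hp {a} v ha hb fun e he hc => by
        simpa using hc.resolve_right (h e he)
  refine not_three_reachable _ (fun v => ?_) hxy hxz hyz (key x hx) (key y hy) (key z hz) rxy rxz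
  refine (ncard_kempe_le hp {a, b} v ha hb fun e he hc => by simpa using hc).trans ?_
  exact Finset.card_le_two

theorem kempe_reachable_of_edge {a b : ℕ} {e : E} {u v : V} (he : ends e = s(u, v))
    (hc : φ e = a ∨ φ e = b) : (kempe ends φ a b).Reachable u v := by
  by_cases h : u = v
  · subst h; rfl
  · exact SimpleGraph.Adj.reachable ⟨h, e, he, hc⟩

theorem kempe_reachable_iff {a b : ℕ} {e : E} {u v w : V} (hu : u ∈ ends e) (hv : v ∈ ends e)
    (hc : φ e = a ∨ φ e = b) :
    (kempe ends φ a b).Reachable w u ↔ (kempe ends φ a b).Reachable w v := by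
  by_cases h : u = v
  · subst h; rfl
  · have : (kempe ends φ a b).Reachable u v :=
      kempe_reachable_of_edge ((Sym2.mem_and_mem_iff h).1 ⟨hu, hv⟩) hc
    exact ⟨fun h => h.trans this, fun h => h.trans this.symm⟩

theorem swap_of_ne {a b : ℕ} {v : V} {e : E} (ha : φ e ≠ a) (hb : φ e ≠ b) :
    kempeSwap ends φ v a b e = φ e := by
  unfold kempeSwap
  split_ifs
  · exact Equiv.swap_apply_of_ne_of_ne ha hb
  · rfl

theorem swap_of_reachable {a b : ℕ} {u v : V} {e : E} (hu : u ∈ ends e)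
    (h : (kempe ends φ a b).Reachable v u) : kempeSwap ends φ v a b e = Equiv.swap a b (φ e) := by
  unfold kempeSwap
  rw [if_pos ⟨u, hu, h⟩]

/-- An edge coloured `a` or `b` has both ends in one component, and other edges are fixed by the
exchange. Hence at each vertex the swap acts on all edges or on none. -/
theorem swap_of_not_reachable {a b : ℕ} {u v : V} {e : E} (hu : u ∈ ends e)
    (h : ¬ (kempe ends φ a b).Reachable v u) : kempeSwap ends φ v a b e = φ e := by
  by_cases hc : φ e = a ∨ φ e = b
  · unfold kempeSwap
    rw [if_neg]
    rintro ⟨w, hw, hr⟩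
    exact h ((kempe_reachable_iff hu hw hc).2 hr)
  · push Not at hc
    exact swap_of_ne hc.1 hc.2

theorem swap_eq_zero {a b : ℕ} (ha : a ≠ 0) (hb : b ≠ 0) {v : V} {e : E} :
    kempeSwap ends φ v a b e = 0 ↔ φ e = 0 := by
  unfold kempeSwap
  split_ifs
  · rw [Equiv.swap_apply_eq_iff, Equiv.swap_apply_of_ne_of_ne ha.symm hb.symm]
  · rfl

theorem swap_le {a b : ℕ} (ha : a ≤ k) (hb : b ≤ k) (h : ∀ e, φ e ≤ k) (v : V) (e : E) :
    kempeSwap ends φ v a b e ≤ k := by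
  unfold kempeSwap
  split_ifs
  · rw [Equiv.swap_apply_def]
    split_ifs <;> first | assumption | exact h e
  · exact h e

theorem Proper.swap (hp : Proper ends φ) {a b : ℕ} (ha : a ≠ 0) (hb : b ≠ 0) (v : V) :
    Proper ends (kempeSwap ends φ v a b) := by
  intro e f w hne he hf h0
  rw [Ne, swap_eq_zero ha hb] at h0
  by_cases hr : (kempe ends φ a b).Reachable v w
  · rw [swap_of_reachable he hr, swap_of_reachable hf hr]
    exact fun h => hp e f w hne he hf h0 ((Equiv.swap a b).injective h)
  · rw [swap_of_not_reachable he hr, swap_of_not_reachable hf hr]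
    exact hp e f w hne he hf h0

theorem missing_swap_of_not_reachable {a b : ℕ} {v w : V}
    (h : ¬ (kempe ends φ a b).Reachable v w) :
    missing ends k (kempeSwap ends φ v a b) w = missing ends k φ w := by
  ext c
  simp only [mem_missing, Misses]
  refine and_congr_right fun _ => forall_congr' fun e => forall_congr' fun he => ?_
  rw [swap_of_not_reachable he h]

theorem mem_missing_swap_of_ne {a b c : ℕ} {v w : V} (ha : c ≠ a) (hb : c ≠ b) :
    c ∈ missing ends k (kempeSwap ends φ v a b) w ↔ c ∈ missing ends k φ w := by
  simp only [mem_missing, Misses]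
  refine and_congr_right fun _ => forall_congr' fun e => forall_congr' fun he => ?_
  unfold kempeSwap
  split_ifs
  · rw [Ne, Equiv.swap_apply_eq_iff, Equiv.swap_apply_of_ne_of_ne ha hb]
  · rfl

theorem mem_missing_swap {a b : ℕ} {v w : V} (hb : 1 ≤ b ∧ b ≤ k)
    (h : (kempe ends φ a b).Reachable v w) (ha : a ∈ missing ends k φ w) :
    b ∈ missing ends k (kempeSwap ends φ v a b) w := by
  rw [mem_missing] at ha ⊢
  refine ⟨hb, fun e he => ?_⟩
  rw [swap_of_reachable he h, Ne, Equiv.swap_apply_eq_iff, Equiv.swap_apply_right]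
  exact ha.2 e he

end Coloring

/-! ### Local search -/

section Search

variable {V E : Type*} {ends : E → Sym2 V} {k : ℕ} {φ ψ : E → ℕ}

/-- The number of uncoloured edges. -/
noncomputable def uncolored (φ : E → ℕ) : ℕ := {e | φ e = 0}.ncard

/-- One move of the local search: give an edge any colour, or exchange two colours on a chain. -/
def Move [DecidableEq E] (ends : E → Sym2 V) (k : ℕ) (φ ψ : E → ℕ) : Prop :=
  (∃ e c, c ≤ k ∧ ψ = Function.update φ e c) ∨
    ∃ v a b, (1 ≤ a ∧ a ≤ k) ∧ (1 ≤ b ∧ b ≤ k) ∧ ψ = kempeSwap ends φ v a b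

/-- No proper colouring with fewer than `u` uncoloured edges is reached in at most `n` moves. -/
def Stuck [DecidableEq E] (ends : E → Sym2 V) (k u : ℕ) : ℕ → (E → ℕ) → Prop
  | 0, φ => Proper ends φ → u ≤ uncolored φ
  | n + 1, φ => Stuck ends k u n φ ∧ ∀ ψ, Move ends k φ ψ → Stuck ends k u n ψ

theorem Stuck.mono [DecidableEq E] {u m n : ℕ} (hmn : m ≤ n) (h : Stuck ends k u n φ) :
    Stuck ends k u m φ := by
  induction hmn with
  | refl => exact h
  | step _ ih => exact ih h.1

/-- The multigraph is loopless, of maximum degree at most `2d + ε`, and `k` is one less than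
Shannon's bound. -/
structure Setting (ends : E → Sym2 V) (k d ε : ℕ) : Prop where
  loopless : ∀ e v, ends e ≠ s(v, v)
  deg_le : ∀ v, {e | v ∈ ends e}.ncard ≤ 2 * d + ε
  colors : k + 1 = 3 * d + ε
  two_le : 2 ≤ d
  parity : ε ≤ 1

/-- A proper colouring with the uncoloured edge `e` between `x` and `y` that cannot be improved by
`n` moves. -/
structure State [DecidableEq E] (ends : E → Sym2 V) (k n : ℕ) (φ : E → ℕ) (e : E) (x y : V) :
    Prop where
  proper : Proper ends φ
  le : ∀ e, φ e ≤ k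
  zero : φ e = 0
  link : ends e = s(x, y)
  stuck : Stuck ends k (uncolored φ) n φ

/-- Move the colour of `f` to the edge `e`. -/
def shiftColor [DecidableEq E] (φ : E → ℕ) (e f : E) : E → ℕ :=
  Function.update (Function.update φ f 0) e (φ f)

theorem Setting.ne {d ε : ℕ} (hS : Setting ends k d ε) {e : E} {x y : V} (h : ends e = s(x, y)) :
    x ≠ y := by
  rintro rfl
  exact hS.loopless e x h

theorem le_card_missing [Finite E] (v : V) :
    k ≤ (missing ends k φ v).card + {e | v ∈ ends e ∧ φ e ≠ 0}.ncard := by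
  classical
  have := Fintype.ofFinite E
  have hsub : Finset.Icc 1 k ⊆
      missing ends k φ v ∪ (Finset.univ.filter fun e => v ∈ ends e ∧ φ e ≠ 0).image φ := by
    intro c hc
    rw [Finset.mem_Icc] at hc
    by_cases h : c ∈ missing ends k φ v
    · exact Finset.mem_union_left _ h
    · obtain ⟨e, w, he, hec⟩ := exists_edge_of_not_missing hc.1 hc.2 h
      refine Finset.mem_union_right _ (Finset.mem_image.2 ⟨e, ?_, hec⟩)
      rw [Finset.mem_filter]
      exact ⟨Finset.mem_univ _, by simp [he], by omega⟩
  have h1 := (Finset.card_le_card hsub).trans (Finset.card_union_le _ _)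
  rw [Nat.card_Icc] at h1
  have h2 := Finset.card_image_le (s := Finset.univ.filter fun e => v ∈ ends e ∧ φ e ≠ 0) (f := φ)
  have h3 : {e | v ∈ ends e ∧ φ e ≠ 0}.ncard
      = (Finset.univ.filter fun e => v ∈ ends e ∧ φ e ≠ 0).card := by
    rw [← Set.ncard_coe_finset]
    simp
  omega

/-- The surplus of colours over the maximum degree is (3d + ε - 1) - (2d + ε) = d - 1. An end of an
uncoloured edge gains one more, see `Setting.le_card_left`. -/
theorem Setting.le_card [Finite E] {d ε : ℕ} (hS : Setting ends k d ε) (v : V) :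
    d ≤ (missing ends k φ v).card + 1 := by
  have h1 := le_card_missing (ends := ends) (k := k) (φ := φ) v
  have h2 : {e | v ∈ ends e ∧ φ e ≠ 0}.ncard ≤ {e | v ∈ ends e}.ncard :=
    Set.ncard_le_ncard (fun e he => he.1) (Set.toFinite _)
  have := hS.deg_le v
  have := hS.colors
  omega

theorem Setting.exists_missing [Finite E] {d ε : ℕ} (hS : Setting ends k d ε) (v : V) :
    ∃ c, c ∈ missing ends k φ v := by
  have h1 := hS.le_card (φ := φ) v
  have := hS.two_le
  exact Finset.card_pos.1 (by omega)

variable {n : ℕ} {e f g : E} {x y z w : V} {a b c d ε : ℕ}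

/-- The colour at `f` is missing at the end `x` of the uncoloured edge `e` between `x` and `y`, and
`f` joins `y` and `z`. -/
structure Fan (ends : E → Sym2 V) (k : ℕ) (φ : E → ℕ) (f : E) (x y z : V) : Prop where
  link : ends f = s(y, z)
  mem : φ f ∈ missing ends k φ x

theorem Fan.left_mem (hf : Fan ends k φ f x y z) : y ∈ ends f := by simp [hf.link]

theorem Fan.right_mem (hf : Fan ends k φ f x y z) : z ∈ ends f := by simp [hf.link]

theorem Fan.ne (hf : Fan ends k φ f x y z) : z ≠ x := by
  rintro rfl
  exact color_ne_of_missing hf.mem hf.right_mem rfl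

variable [DecidableEq E]

theorem State.symm (h : State ends k n φ e x y) : State ends k n φ e y x :=
  ⟨h.proper, h.le, h.zero, h.link.trans Sym2.eq_swap, h.stuck⟩

theorem State.left_mem (h : State ends k n φ e x y) : x ∈ ends e := by simp [h.link]

theorem Setting.le_card_left [Finite E] (hS : Setting ends k d ε)
    (h : State ends k n φ e x y) : d ≤ (missing ends k φ x).card := by
  have h1 := le_card_missing (ends := ends) (k := k) (φ := φ) x
  have h2 : {e | x ∈ ends e ∧ φ e ≠ 0}.ncard < {e | x ∈ ends e}.ncard := by
    refine Set.ncard_lt_ncard ⟨fun e he => he.1, fun hsub => ?_⟩ (Set.toFinite _)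
    exact (hsub h.left_mem).2 h.zero
  have := hS.deg_le x
  have := hS.colors
  omega

theorem Setting.le_card_right [Finite E] (hS : Setting ends k d ε)
    (h : State ends k n φ e x y) : d ≤ (missing ends k φ y).card :=
  hS.le_card_left h.symm

theorem Setting.exists_ne [Finite E] (hS : Setting ends k d ε)
    (h : State ends k n φ e x y) (a : ℕ) : ∃ b ∈ missing ends k φ x, b ≠ a := by
  have h1 := hS.le_card_left h
  have := hS.two_le
  exact Finset.exists_mem_ne (by omega) a

/-- An exchange of nonzero colours keeps properness and the uncoloured edges, so it only spends one
move of the budget. The offsets `n + j` in the lemmas below count such costs: one per exchange or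
recolouring, two per shift. -/
theorem State.swap (h : State ends k (n + 1) φ e x y) (v : V) (ha : 1 ≤ a ∧ a ≤ k)
    (hb : 1 ≤ b ∧ b ≤ k) : State ends k n (kempeSwap ends φ v a b) e x y := by
  have ha0 : a ≠ 0 := by omega
  have hb0 : b ≠ 0 := by omega
  refine ⟨h.proper.swap ha0 hb0 v, swap_le ha.2 hb.2 h.le v, (swap_eq_zero ha0 hb0).2 h.zero,
    h.link, ?_⟩
  have hu : uncolored (kempeSwap ends φ v a b) = uncolored φ := by
    simp only [uncolored, swap_eq_zero ha0 hb0]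
  rw [hu]
  exact h.stuck.2 _ (Or.inr ⟨v, a, b, ha, hb, rfl⟩)

theorem shift_left : shiftColor φ e f e = φ f := by simp [shiftColor]

theorem shift_right (hne : f ≠ e) : shiftColor φ e f f = 0 := by simp [shiftColor, hne]

theorem shift_of_ne (he : g ≠ e) (hf : g ≠ f) : shiftColor φ e f g = φ g := by
  simp [shiftColor, he, hf]

theorem State.fan_ne (h : State ends k n φ e x y) (hf : Fan ends k φ f x y z) : f ≠ e := by
  rintro rfl
  exact missing_pos hf.mem h.zero

/-- The shift adds a colour at `x` only, namely `φ f`; at `y` this colour passes from `f` to `e`,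
and at `z` it disappears. -/
theorem State.mem_missing_shift (h : State ends k n φ e x y) (hf : Fan ends k φ f x y z)
    (hc : c ∈ missing ends k φ w) (hw : c ≠ φ f ∨ w ≠ x) :
    c ∈ missing ends k (shiftColor φ e f) w := by
  rw [mem_missing] at hc ⊢
  refine ⟨hc.1, fun g hg => ?_⟩
  by_cases h1 : g = e
  · subst h1
    rw [shift_left]
    rintro rfl
    have hwx := hw.resolve_left (fun h => h rfl)
    rw [h.link, Sym2.mem_iff] at hg
    obtain rfl := hg.resolve_left hwx
    exact hc.2 f hf.left_mem rfl
  · by_cases h2 : g = f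
    · subst h2
      rw [shift_right h1]
      omega
    · rw [shift_of_ne h1 h2]
      exact hc.2 g hg

theorem State.color_mem_missing_shift (hS : Setting ends k d ε) (h : State ends k n φ e x y)
    (hf : Fan ends k φ f x y z) :
    φ f ∈ missing ends k (shiftColor φ e f) z := by
  rw [mem_missing]
  have hz := hf.ne
  have hzy := hS.ne hf.link
  refine ⟨(mem_missing.1 hf.mem).1, fun g hg => ?_⟩
  by_cases h1 : g = e
  · subst h1
    rw [h.link, Sym2.mem_iff] at hg
    exact absurd hg (not_or.2 ⟨hz, hzy.symm⟩)
  · by_cases h2 : g = f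
    · subst h2
      rw [shift_right h1]
      exact (missing_pos hf.mem).symm
    · rw [shift_of_ne h1 h2]
      exact fun heq => h2 (h.proper.eq hg hf.right_mem (heq ▸ missing_pos hf.mem) heq)

/-- Uncolouring `f` and giving its colour to `e` are two moves that keep the number of uncoloured
edges. The colour fits on `e` since it was missing at `x` and `f` was its only edge at `y`. Now `f`
is uncoloured and `z` plays the role of `x`. -/
theorem State.shift [Finite E] (h : State ends k (n + 2) φ e x y) (hf : Fan ends k φ f x y z) :
    State ends k n (shiftColor φ e f) f z y := by
  have hne := h.fan_ne hf
  refine ⟨?_, ?_, shift_right hne, hf.link.trans Sym2.eq_swap, ?_⟩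
  · have key : ∀ g v, v ∈ ends e → v ∈ ends g → g ≠ e → g ≠ f → φ g ≠ φ f := by
      intro g v he hg h1 h2 heq
      rw [h.link, Sym2.mem_iff] at he
      rcases he with rfl | rfl
      · exact color_ne_of_missing hf.mem hg heq
      · exact h2 (h.proper.eq hg hf.left_mem (heq ▸ missing_pos hf.mem) heq)
    intro g g' v hgg hg hg' h0
    by_cases h1 : g = e
    · subst h1
      by_cases h2 : g' = f
      · subst h2
        rw [shift_right hne]
        exact h0
      · rw [shift_left, shift_of_ne hgg.symm h2]
        exact (key g' v hg hg' hgg.symm h2).symm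
    · have h2 : g ≠ f := by
        rintro rfl
        exact h0 (shift_right hne)
      rw [shift_of_ne h1 h2] at h0 ⊢
      by_cases h3 : g' = e
      · subst h3
        rw [shift_left]
        exact key g v hg' hg h1 h2
      · by_cases h4 : g' = f
        · subst h4
          rw [shift_right hne]
          exact h0
        · rw [shift_of_ne h3 h4]
          exact h.proper g g' v hgg hg hg' h0
  · intro g
    by_cases h1 : g = e
    · subst h1
      rw [shift_left]
      exact h.le f
    · by_cases h2 : g = f
      · subst h2
        rw [shift_right h1]
        exact Nat.zero_le _
      · rw [shift_of_ne h1 h2]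
        exact h.le g
  · have hset : {g | shiftColor φ e f g = 0} = insert f ({g | φ g = 0} \ {e}) := by
      ext g
      simp only [Set.mem_ofPred_eq, Set.mem_insert_iff, Set.mem_sdiff, Set.mem_singleton_iff]
      by_cases h1 : g = e
      · subst h1
        simp [shift_left, missing_pos hf.mem, hne.symm]
      · by_cases h2 : g = f
        · subst h2
          simp [shift_right h1]
        · simp [shift_of_ne h1 h2, h1, h2]
    have hu : uncolored (shiftColor φ e f) = uncolored φ := by
      have he : e ∈ {g | φ g = 0} := h.zero
      rw [uncolored, hset, Set.ncard_insert_of_notMem, Set.ncard_sdiff_singleton_add_one he]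
      · rfl
      · simp [missing_pos hf.mem]
    rw [hu]
    exact (h.stuck.2 _ (Or.inl ⟨f, 0, Nat.zero_le _, rfl⟩)).2 _ (Or.inl ⟨e, φ f, h.le f, rfl⟩)

/-- After the shift, `e` is a fan edge for `f`. -/
theorem State.shift_fan (hS : Setting ends k d ε) (h : State ends k n φ e x y)
    (hf : Fan ends k φ f x y z) : Fan ends k (shiftColor φ e f) e z y x :=
  ⟨h.link.trans Sym2.eq_swap, by rw [shift_left]; exact h.color_mem_missing_shift hS hf⟩

theorem State.shift_color (h : State ends k n φ e x y) (hf : Fan ends k φ f x y z)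
    (h0 : φ g ≠ 0) (h1 : φ g ≠ φ f) : shiftColor φ e f g = φ g :=
  shift_of_ne (by rintro rfl; exact h0 h.zero) (by rintro rfl; exact h1 rfl)

end Search

/-! ### Disjointness of missing sets: fans and Kierstead paths -/

section Fans

variable {V E : Type*} {ends : E → Sym2 V} {k : ℕ} {φ ψ : E → ℕ} [Finite V] [Finite E]
  [DecidableEq E] {n : ℕ} {e f f' g : E} {x y z z' w u : V} {a b c d ε : ℕ}

omit [Finite V] in
/-- No colour is missing at both ends of an uncoloured edge. -/
theorem State.not_mem (h : State ends k (n + 1) φ e x y) (hx : c ∈ missing ends k φ x) :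
    c ∉ missing ends k φ y := by
  intro hy
  have hc := mem_missing.1 hx
  have hmem : ∀ g v, v ∈ ends e → v ∈ ends g → φ g ≠ c := by
    intro g v hv hg
    rw [h.link, Sym2.mem_iff] at hv
    rcases hv with rfl | rfl
    · exact color_ne_of_missing hx hg
    · exact color_ne_of_missing hy hg
  have hp : Proper ends (Function.update φ e c) := by
    intro g g' v hne hg hg' h0
    by_cases h1 : g = e
    · subst h1
      rw [Function.update_self, Function.update_of_ne hne.symm]
      exact (hmem g' v hg hg').symm
    · rw [Function.update_of_ne h1] at h0 ⊢
      by_cases h2 : g' = e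
      · subst h2
        rw [Function.update_self]
        exact hmem g v hg' hg
      · rw [Function.update_of_ne h2]
        exact h.proper g g' v hne hg hg' h0
  have h1 := (h.stuck.2 _ (Or.inl ⟨e, c, hc.1.2, rfl⟩)).mono (Nat.zero_le _) hp
  have h2 : uncolored (Function.update φ e c) < uncolored φ := by
    refine Set.ncard_lt_ncard ⟨fun g hg => ?_, fun hsub => ?_⟩ (Set.toFinite _)
    · have hge : g ≠ e := by
        rintro rfl
        simp only [Set.mem_ofPred_eq, Function.update_self] at hg
        omega
      simpa [Function.update_of_ne hge] using hg
    · have := hsub (show e ∈ {g | φ g = 0} from h.zero)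
      simp only [Set.mem_ofPred_eq, Function.update_self] at this
      omega
  omega

omit [Finite V] in
-- After the shift the uncoloured edge joins `z` and `y`, and `State.not_mem` applies to it: two
-- moves for the shift, one for the colouring.
theorem State.not_mem_right (hS : Setting ends k d ε) (h : State ends k (n + 3) φ e x y)
    (hf : Fan ends k φ f x y z) (hz : c ∈ missing ends k φ z) : c ∉ missing ends k φ y := by
  intro hy
  exact (h.shift hf).not_mem (h.mem_missing_shift hf hz (Or.inr hf.ne))
    (h.mem_missing_shift hf hy (Or.inr (hS.ne h.link).symm))

omit [Finite V] in
/-- Missing colours of `x` and `y` are linked by a Kempe chain. -/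
theorem State.reachable (h : State ends k (n + 2) φ e x y) (hb : b ∈ missing ends k φ y)
    (hc : c ∈ missing ends k φ x) : (kempe ends φ b c).Reachable y x := by
  by_contra hr
  have hb1 := (mem_missing.1 hb).1
  have hc1 := (mem_missing.1 hc).1
  -- With `x` off the chain of `y`, the exchange would make `c` missing at both ends of the
  -- uncoloured edge.
  refine (h.swap y hb1 hc1).not_mem (c := c) ?_ (mem_missing_swap hc1 (by rfl) hb)
  rwa [missing_swap_of_not_reachable hr]

omit [Finite V] in
/-- Missing colours of `y` and a fan vertex `z` are linked by a Kempe chain. -/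
theorem State.reachable_fan (hS : Setting ends k d ε) (h : State ends k (n + 4) φ e x y)
    (hf : Fan ends k φ f x y z) (hb : b ∈ missing ends k φ y) (hc : c ∈ missing ends k φ z) :
    (kempe ends φ b c).Reachable y z := by
  by_contra hr
  have hb1 := (mem_missing.1 hb).1
  have hc1 := (mem_missing.1 hc).1
  have hfb : φ f ≠ b := color_ne_of_missing hb hf.left_mem
  have hfc : φ f ≠ c := color_ne_of_missing hc hf.right_mem
  have hf' : Fan ends k (kempeSwap ends φ y b c) f x y z := by
    refine ⟨hf.link, ?_⟩
    rw [swap_of_ne hfb hfc, mem_missing_swap_of_ne hfb hfc]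
    exact hf.mem
  refine (h.swap y hb1 hc1).not_mem_right hS hf' (c := c) ?_ (mem_missing_swap hc1 (by rfl) hb)
  rwa [missing_swap_of_not_reachable hr]

/-- A common colour of `x` and `z`, paired with any colour missing at `y`, would give a chain with
the three ends `x`, `y`, `z`. -/
theorem State.not_mem_left (hS : Setting ends k d ε) (h : State ends k (n + 4) φ e x y)
    (hf : Fan ends k φ f x y z) (hz : c ∈ missing ends k φ z) : c ∉ missing ends k φ x := by
  intro hx
  obtain ⟨b, hb⟩ := hS.exists_missing (φ := φ) y
  exact three_ends h.proper (missing_pos hb) (missing_pos hx) (hS.ne h.link).symm (hS.ne hf.link)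
    hf.ne.symm (Or.inl (mem_missing.1 hb).2) (Or.inr (mem_missing.1 hx).2)
    (Or.inr (mem_missing.1 hz).2) (h.reachable hb hx) (h.reachable_fan hS hf hb hz)

/-- Distinct fan vertices have disjoint missing sets. -/
theorem State.not_mem_fan (hS : Setting ends k d ε) (h : State ends k (n + 4) φ e x y)
    (hf : Fan ends k φ f x y z) (hf' : Fan ends k φ f' x y z') (hzz : z ≠ z')
    (hz : c ∈ missing ends k φ z) : c ∉ missing ends k φ z' := by
  intro hz'
  obtain ⟨b, hb⟩ := hS.exists_missing (φ := φ) y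
  exact three_ends h.proper (missing_pos hb) (missing_pos hz) (hS.ne hf.link) (hS.ne hf'.link)
    hzz (Or.inl (mem_missing.1 hb).2) (Or.inr (mem_missing.1 hz).2)
    (Or.inr (mem_missing.1 hz').2) (h.reachable_fan hS hf hb hz) (h.reachable_fan hS hf' hb hz')

/-- A fan vertex at `y` and a different fan vertex at `x` have disjoint missing sets. -/
theorem State.not_mem_opposite (hS : Setting ends k d ε) (h : State ends k (n + 5) φ e x y)
    (hf : Fan ends k φ f x y z) (hf' : Fan ends k φ f' y x z') (hzz : z ≠ z')
    (hz : c ∈ missing ends k φ z) : c ∉ missing ends k φ z' := by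
  intro hz'
  -- The colour of `f'` is itself missing at `y`. A second missing colour `b` is taken so that `f'`
  -- remains a fan edge when `b` and `c` are exchanged.
  obtain ⟨b, hb, hbf⟩ := hS.exists_ne h.symm (φ f')
  have hb1 := (mem_missing.1 hb).1
  have hc1 := (mem_missing.1 hz).1
  refine three_ends h.proper (missing_pos hb) (missing_pos hz) (hS.ne hf.link) hf'.ne.symm
    hzz (Or.inl (mem_missing.1 hb).2) (Or.inr (mem_missing.1 hz).2)
    (Or.inr (mem_missing.1 hz').2) (h.reachable_fan hS hf hb hz) ?_
  by_contra hr
  have hfc : φ f' ≠ c := color_ne_of_missing hz' hf'.right_mem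
  have hf'' : Fan ends k (kempeSwap ends φ y b c) f' y x z' := by
    refine ⟨hf'.link, ?_⟩
    rw [swap_of_ne hbf.symm hfc, mem_missing_swap_of_ne hbf.symm hfc]
    exact hf'.mem
  refine (h.swap y hb1 hc1).symm.not_mem_left hS hf'' (c := c) ?_ (mem_missing_swap hc1 (by rfl) hb)
  rwa [missing_swap_of_not_reachable hr]

/-- The Kierstead path `x, y, z, w` whose last edge has a colour missing at `x`. -/
theorem State.not_mem_path (hS : Setting ends k d ε) (h : State ends k (n + 8) φ e x y)
    (hf : Fan ends k φ f x y z) (hg : ends g = s(z, w)) (hgx : φ g ∈ missing ends k φ x)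
    (hwy : w ≠ y) (hw : c ∈ missing ends k φ w) : c ∉ missing ends k φ y := by
  intro hy
  have hwg : w ∈ ends g := by simp [hg]
  have hwx : w ≠ x := by
    rintro rfl
    exact color_ne_of_missing hgx hwg rfl
  have hfg : φ f ≠ φ g := by
    intro heq
    exact hwy ((h.proper.end_eq (hf.link.trans Sym2.eq_swap) hg (missing_pos hf.mem) heq).symm)
  have hc1 := (mem_missing.1 hw).1
  have ha1 := (mem_missing.1 hgx).1
  have hgc : φ g ≠ c := color_ne_of_missing hw hwg
  have hfc : φ f ≠ c := color_ne_of_missing hy hf.left_mem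
  have hyx := h.reachable hy hgx
  have hnot : ¬ (kempe ends φ c (φ g)).Reachable y w := fun hr =>
    three_ends h.proper (missing_pos hw) (missing_pos hgx) (hS.ne h.link).symm hwy.symm hwx.symm
      (Or.inl (mem_missing.1 hy).2) (Or.inr (mem_missing.1 hgx).2) (Or.inl (mem_missing.1 hw).2)
      hyx hr
  have hwy' : ¬ (kempe ends φ c (φ g)).Reachable w y := fun hr => hnot hr.symm
  have hwx' : ¬ (kempe ends φ c (φ g)).Reachable w x := fun hr => hnot (hyx.trans hr.symm)
  -- The chain of `y` ends at `x`, so `w` lies on another one. Exchanging there keeps the missing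
  -- sets of `x` and `y`, gives `g` the colour `c`, and makes the old colour of `g` missing at `w`.
  have hs := h.swap w hc1 ha1
  have hMx := missing_swap_of_not_reachable (k := k) hwx'
  have hMy := missing_swap_of_not_reachable (k := k) hwy'
  have hMw := mem_missing_swap ha1 (SimpleGraph.Reachable.refl w) hw
  have hfψ : kempeSwap ends φ w c (φ g) f = φ f := swap_of_ne hfc hfg
  have hgψ : kempeSwap ends φ w c (φ g) g = c := by
    rw [swap_of_reachable hwg (SimpleGraph.Reachable.refl w), Equiv.swap_apply_right]
  have hf' : Fan ends k (kempeSwap ends φ w c (φ g)) f x y z :=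
    ⟨hf.link, by rw [hfψ, hMx]; exact hf.mem⟩
  have hgcol : shiftColor (kempeSwap ends φ w c (φ g)) e f g = c := by
    rw [hs.shift_color hf' (by rw [hgψ]; exact missing_pos hw) (by rw [hgψ, hfψ]; exact hfc.symm),
      hgψ]
  -- Once `f` is the uncoloured edge, `e` is a fan edge at `y` leading to `x` and `g` is a fan edge
  -- at `z` leading to `w`; both `x` and `w` miss the old colour of `g`.
  refine (hs.shift hf').not_mem_opposite hS (c := φ g) (hs.shift_fan hS hf') (f' := g) (z' := w)
    ⟨hg, ?_⟩ hwx.symm ?_ ?_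
  · rw [hgcol]
    exact hs.mem_missing_shift hf' (by rwa [hMy]) (Or.inr (hS.ne h.link).symm)
  · exact hs.mem_missing_shift hf' (by rwa [hMx]) (Or.inl (by rw [hfψ]; exact hfg.symm))
  · exact hs.mem_missing_shift hf' hMw (Or.inr hwx)

/-- The missing set at the end of such a Kierstead path is disjoint from those of `x` and of the
fan vertices. -/
theorem State.not_mem_path_of_reachable (hS : Setting ends k d ε)
    (h : State ends k (n + 9) φ e x y) (hf : Fan ends k φ f x y z) (hg : ends g = s(z, w))
    (hgx : φ g ∈ missing ends k φ x) (hwy : w ≠ y) (hw : c ∈ missing ends k φ w) (huw : u ≠ w)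
    (huy : u ≠ y) (hu : c ∈ missing ends k φ u)
    (hlink : ∀ b ∈ missing ends k φ y, (kempe ends φ b c).Reachable y u) : False := by
  obtain ⟨b, hb⟩ := hS.exists_missing (φ := φ) y
  have hwg : w ∈ ends g := by simp [hg]
  have hc1 := (mem_missing.1 hw).1
  have hb1 := (mem_missing.1 hb).1
  have hnot : ¬ (kempe ends φ b c).Reachable y w := fun hr =>
    three_ends h.proper (missing_pos hb) (missing_pos hw) huy.symm hwy.symm huw
      (Or.inl (mem_missing.1 hb).2) (Or.inr (mem_missing.1 hu).2) (Or.inr (mem_missing.1 hw).2)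
      (hlink b hb) hr
  have hwy' : ¬ (kempe ends φ c b).Reachable w y := fun hr =>
    hnot (by rw [kempe_comm]; exact hr.symm)
  -- The chain of `y` already has the ends `y` and `u`, so `w` is on a different one. The exchange
  -- there makes `b` missing at `w` while it stays missing at `y`, which reduces to
  -- `State.not_mem_path`.
  have hs := h.swap w hc1 hb1
  have hMy := missing_swap_of_not_reachable (k := k) hwy'
  have hMw := mem_missing_swap hb1 (SimpleGraph.Reachable.refl w) hw
  have hfψ : kempeSwap ends φ w c b f = φ f := swap_of_not_reachable hf.left_mem hwy'
  have hgb : φ g ≠ b := fun heq => h.not_mem (heq ▸ hgx) hb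
  have hgc : φ g ≠ c := color_ne_of_missing hw hwg
  have hgψ : kempeSwap ends φ w c b g = φ g := swap_of_ne hgc hgb
  -- The colour of `f` stays missing at `x` even if it equals `c`: in that case `x` is on the chain
  -- of `y`, which avoids `w`.
  have hfx : φ f ∈ missing ends k (kempeSwap ends φ w c b) x := by
    have hfb : φ f ≠ b := color_ne_of_missing hb hf.left_mem
    by_cases hfc : φ f = c
    · rw [missing_swap_of_not_reachable]
      · exact hf.mem
      · intro hr
        refine hwy' (hr.trans ?_)
        rw [kempe_comm]
        exact (h.reachable hb (hfc ▸ hf.mem)).symm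
    · exact (mem_missing_swap_of_ne hfc hfb).2 hf.mem
  refine hs.not_mem_path hS (f := f) (g := g) ⟨hf.link, by rwa [hfψ]⟩ hg ?_ hwy hMw (by rwa [hMy])
  rw [hgψ]
  exact (mem_missing_swap_of_ne hgc hgb).2 hgx

/-- The Kierstead path `x, y, z, w` whose last edge has a colour missing at `y`. -/
theorem State.not_mem_path' (hS : Setting ends k d ε) (h : State ends k (n + 7) φ e x y)
    (hf : Fan ends k φ f x y z) (hg : ends g = s(z, w)) (hgy : φ g ∈ missing ends k φ y)
    (hwx : w ≠ x) (hw : c ∈ missing ends k φ w) :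
    c ∉ missing ends k φ x ∧ c ∉ missing ends k φ y ∧ c ∉ missing ends k φ z ∧ c ≠ φ f := by
  have hyx := (hS.ne h.link).symm
  have hs := h.shift hf
  have hgf : φ g ≠ φ f := fun heq => color_ne_of_missing hgy hf.left_mem heq.symm
  -- After the shift `g` is a fan edge at `z` for the uncoloured edge `f`, so `w` is a fan vertex
  -- and the disjointness results apply to it. The shift also makes the colour of `f` missing at
  -- `z`, whence `c ≠ φ f`.
  have hg' : Fan ends k (shiftColor φ e f) g y z w := by
    refine ⟨hg, ?_⟩
    rw [h.shift_color hf (missing_pos hgy) hgf]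
    exact h.mem_missing_shift hf hgy (Or.inr hyx)
  have hw' := h.mem_missing_shift hf hw (Or.inr hwx)
  have hcf : c ≠ φ f := by
    rintro rfl
    exact hs.symm.not_mem_right hS hg' hw' (h.color_mem_missing_shift hS hf)
  refine ⟨fun hx => ?_, fun hy => ?_, fun hz => ?_, hcf⟩
  · exact hs.not_mem_opposite hS (h.shift_fan hS hf) hg' hwx.symm
      (h.mem_missing_shift hf hx (Or.inl hcf)) hw'
  · exact hs.symm.not_mem_left hS hg' hw' (h.mem_missing_shift hf hy (Or.inr hyx))
  · exact hs.symm.not_mem_right hS hg' hw' (h.mem_missing_shift hf hz (Or.inr hf.ne))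

end Fans

/-! ### The triangle spanned by an uncoloured edge and its fan vertex -/

section Triangle

variable {V E : Type*} {ends : E → Sym2 V} {k : ℕ} {φ φ' : E → ℕ}
  {n : ℕ} {e f f' f₂ g h : E} {x y z z' w u v p q : V} {a b c d ε ω : ℕ}

theorem missing_subset : missing ends k φ v ⊆ Finset.Icc 1 k := fun _ hc =>
  Finset.mem_Icc.2 (mem_missing.1 hc).1

/-- Four disjoint missing sets of these sizes exhaust the colours. -/
theorem mem_of_disjoint {A B C D : Finset ℕ} (hA : A ⊆ Finset.Icc 1 k) (hB : B ⊆ Finset.Icc 1 k)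
    (hC : C ⊆ Finset.Icc 1 k) (hD : D ⊆ Finset.Icc 1 k) (hAB : ∀ c ∈ A, c ∉ B)
    (hAC : ∀ c ∈ A, c ∉ C) (hAD : ∀ c ∈ A, c ∉ D) (hBC : ∀ c ∈ B, c ∉ C) (hBD : ∀ c ∈ B, c ∉ D)
    (hCD : ∀ c ∈ C, c ∉ D) (hk : k + 2 ≤ 4 * d) (cA : d ≤ A.card) (cB : d ≤ B.card)
    (cC : d ≤ C.card + 1) (cD : d ≤ D.card + 1) (hc : c ∈ Finset.Icc 1 k) :
    c ∈ A ∨ c ∈ B ∨ c ∈ C ∨ c ∈ D := by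
  have h1 : ((A ∪ B) ∪ (C ∪ D)).card = A.card + B.card + (C.card + D.card) := by
    rw [Finset.card_union_of_disjoint, Finset.card_union_of_disjoint, Finset.card_union_of_disjoint]
    · exact Finset.disjoint_left.2 hCD
    · exact Finset.disjoint_left.2 hAB
    · rw [Finset.disjoint_left]
      intro c hc
      rw [Finset.mem_union, not_or]
      rcases Finset.mem_union.1 hc with h | h
      · exact ⟨hAC c h, hAD c h⟩
      · exact ⟨hBC c h, hBD c h⟩
  have h2 : (A ∪ B) ∪ (C ∪ D) = Finset.Icc 1 k := by
    refine Finset.eq_of_subset_of_card_le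
      (Finset.union_subset (Finset.union_subset hA hB) (Finset.union_subset hC hD)) ?_
    rw [h1, Nat.card_Icc]
    omega
  rw [← h2] at hc
  simpa [or_assoc] using hc

/-- This is the count d + d + (d - 1) + (d - 1) ≥ k needed for `mem_of_disjoint`. It amounts to d ≥
1 + ε, which holds because d ≥ 2 and ε ≤ 1. -/
theorem Setting.colors_le {d : ℕ} (hS : Setting ends k d ε) : k + 2 ≤ 4 * d := by
  have := hS.colors
  have := hS.two_le
  have := hS.parity
  omega

theorem kempe_mono (hφ : ∀ g, (φ' g = a ∨ φ' g = b) → φ g = φ' g) :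
    kempe ends φ' a b ≤ kempe ends φ a b := by
  rintro u v ⟨hne, g, hg, hc⟩
  exact ⟨hne, g, hg, by rwa [hφ g hc]⟩

/-- Deleting an edge at `p` from a Kempe chain. -/
theorem reachable_or_of_agree (hφ : ∀ g, g ≠ f → φ g = φ' g) (hf : ends f = s(p, q))
    (hr : (kempe ends φ' a b).Reachable u p) :
    (kempe ends φ a b).Reachable u p ∨ (kempe ends φ a b).Reachable u q := by
  obtain ⟨W⟩ := hr
  induction W with
  | nil => exact Or.inl (SimpleGraph.Reachable.refl _)
  | cons hadj _ ih =>
    obtain ⟨hne, g, hg, hc⟩ := hadj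
    by_cases hgf : g = f
    · subst hgf
      rw [hf, Sym2.eq_iff] at hg
      rcases hg with ⟨rfl, rfl⟩ | ⟨rfl, rfl⟩
      · exact Or.inl (SimpleGraph.Reachable.refl _)
      · exact Or.inr (SimpleGraph.Reachable.refl _)
    · have hr := kempe_reachable_of_edge (φ := φ) hg (by rwa [hφ g hgf])
      exact (ih hf).imp hr.trans hr.trans

variable [Finite V] [Finite E] [DecidableEq E]

/-- All fan edges at `y` lead to the same vertex. -/
theorem State.fan_unique (hS : Setting ends k d ε) (hs : State ends k (n + 9) φ e x y)
    (hf : Fan ends k φ f x y z) (hf' : Fan ends k φ f' x y z') : z = z' := by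
  by_contra hzz
  have hyz := hS.ne hf.link
  have hyz' := hS.ne hf'.link
  -- The edge at `z` with the colour of `f'` leads to a fifth vertex `w`. Since `x`, `y`, `z`, `z'`
  -- exhaust the colours, a colour missing at `w` is missing at one of them, and each case
  -- contradicts the Kierstead path `x, y, z, w`.
  have hcol : φ f' ∉ missing ends k φ z := fun hm => hs.not_mem_left hS hf hm hf'.mem
  have hcr := (mem_missing.1 hf'.mem).1
  obtain ⟨g, w, hg, hgc⟩ := exists_edge_of_not_missing hcr.1 hcr.2 hcol
  have hgx : φ g ∈ missing ends k φ x := by rw [hgc]; exact hf'.mem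
  have hg0 := missing_pos hgx
  have hwg : w ∈ ends g := by simp [hg]
  have hwy : w ≠ y := by
    rintro rfl
    exact hzz (hs.proper.end_eq (hg.trans Sym2.eq_swap) hf'.link hg0 hgc)
  have hwx : w ≠ x := by
    rintro rfl
    exact color_ne_of_missing hgx hwg rfl
  have hwz : w ≠ z := (hS.ne hg).symm
  have hwz' : w ≠ z' := by
    rintro rfl
    exact hyz (hs.proper.end_eq (hg.trans Sym2.eq_swap) (hf'.link.trans Sym2.eq_swap) hg0 hgc).symm
  obtain ⟨c, hc⟩ := hS.exists_missing (φ := φ) w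
  rcases mem_of_disjoint missing_subset missing_subset missing_subset missing_subset
    (A := missing ends k φ x) (B := missing ends k φ y) (C := missing ends k φ z)
    (D := missing ends k φ z')
    (fun _ h => hs.not_mem h) (fun _ h h' => hs.not_mem_left hS hf h' h)
    (fun _ h h' => hs.not_mem_left hS hf' h' h) (fun _ h h' => hs.not_mem_right hS hf h' h)
    (fun _ h h' => hs.not_mem_right hS hf' h' h) (fun _ h => hs.not_mem_fan hS hf hf' hzz h)
    hS.colors_le (hS.le_card_left hs) (hS.le_card_right hs) (hS.le_card z) (hS.le_card z')
    (missing_subset hc) with h | h | h | h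
  · exact hs.not_mem_path_of_reachable hS hf hg hgx hwy hc hwx.symm (hS.ne hs.link) h
      fun b hb => hs.reachable hb h
  · exact hs.not_mem_path hS hf hg hgx hwy hc h
  · exact hs.not_mem_path_of_reachable hS hf hg hgx hwy hc hwz.symm hyz.symm h
      fun b hb => hs.reachable_fan hS hf hb h
  · exact hs.not_mem_path_of_reachable hS hf hg hgx hwy hc hwz'.symm hyz'.symm h
      fun b hb => hs.reachable_fan hS hf' hb h

/-- After the shift along `f`, both `g` and `e` are fan edges at `y` for the uncoloured edge between
`z` and `y`, so they lead to the same vertex. -/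
theorem State.second_fan (hS : Setting ends k d ε) (hs : State ends k (n + 11) φ e x y)
    (hf : Fan ends k φ f x y z) (hg : ends g = s(y, w)) (hgz : φ g ∈ missing ends k φ z) :
    w = x := by
  have hgf : φ g ≠ φ f := (color_ne_of_missing hgz hf.right_mem).symm
  refine (hs.shift hf).fan_unique hS (f := g) ⟨hg, ?_⟩ (hs.shift_fan hS hf)
  rw [hs.shift_color hf (missing_pos hgz) hgf]
  exact hs.mem_missing_shift hf hgz (Or.inl hgf)

/-- The fan edges at `x` lead to the same vertex as those at `y`. -/
theorem State.fan_eq_opposite (hS : Setting ends k d ε) (hs : State ends k (n + 9) φ e x y)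
    (hf : Fan ends k φ f x y z) (hf' : Fan ends k φ f' y x z') : z = z' := by
  by_contra hzz
  have hcol : φ f' ∉ missing ends k φ z := fun hm => hs.not_mem_right hS hf hm hf'.mem
  have hcr := (mem_missing.1 hf'.mem).1
  obtain ⟨g, w, hg, hgc⟩ := exists_edge_of_not_missing hcr.1 hcr.2 hcol
  have hgy : φ g ∈ missing ends k φ y := by rw [hgc]; exact hf'.mem
  have hg0 := missing_pos hgy
  have hwg : w ∈ ends g := by simp [hg]
  have hwx : w ≠ x := by
    rintro rfl
    exact hzz (hs.proper.end_eq (hg.trans Sym2.eq_swap) hf'.link hg0 hgc)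
  have hwz' : w ≠ z' := by
    rintro rfl
    exact hf.ne (hs.proper.end_eq (hg.trans Sym2.eq_swap) (hf'.link.trans Sym2.eq_swap) hg0 hgc)
  obtain ⟨c, hc⟩ := hS.exists_missing (φ := φ) w
  have hpath := hs.not_mem_path' hS hf hg hgy hwx hc
  rcases mem_of_disjoint missing_subset missing_subset missing_subset missing_subset
    (A := missing ends k φ x) (B := missing ends k φ y) (C := missing ends k φ z)
    (D := missing ends k φ z')
    (fun _ h => hs.not_mem h) (fun _ h h' => hs.not_mem_left hS hf h' h)
    (fun _ h h' => hs.symm.not_mem_right hS hf' h' h) (fun _ h h' => hs.not_mem_right hS hf h' h)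
    (fun _ h h' => hs.symm.not_mem_left hS hf' h' h)
    (fun _ h => hs.not_mem_opposite hS hf hf' hzz h)
    hS.colors_le (hS.le_card_left hs) (hS.le_card_right hs) (hS.le_card z) (hS.le_card z')
    (missing_subset hc) with h | h | h | h
  · exact hpath.1 h
  · exact hpath.2.1 h
  · exact hpath.2.2.1 h
  -- In the remaining case `w` and `z'` share the colour `c`. The chain of `b` and `c` through `x`
  -- ends at `z'` and misses `w`; exchanging at `w` makes `b` missing at `w` and at `x`, against
  -- `State.not_mem_path'`. The choice `b ≠ φ f` keeps `f` a fan edge.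
  obtain ⟨b, hb, hbf⟩ := hS.exists_ne hs (φ f)
  have hb1 := (mem_missing.1 hb).1
  have hc1 := (mem_missing.1 hc).1
  have hxz' := hs.symm.reachable_fan hS hf' hb h
  have hwx' : ¬ (kempe ends φ c b).Reachable w x := by
    intro hr
    rw [kempe_comm] at hr
    exact three_ends hs.proper (missing_pos hb) (missing_pos hc) (hS.ne hf'.link) hwx.symm
      hwz'.symm (Or.inl (mem_missing.1 hb).2) (Or.inr (mem_missing.1 h).2)
      (Or.inr (mem_missing.1 hc).2) hxz' hr.symm
  have hs' := hs.swap w hc1 hb1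
  have hMx := missing_swap_of_not_reachable (k := k) hwx'
  have hMw := mem_missing_swap hb1 (SimpleGraph.Reachable.refl w) hc
  have hf2 : Fan ends k (kempeSwap ends φ w c b) f x y z := by
    refine ⟨hf.link, ?_⟩
    rw [swap_of_ne hpath.2.2.2.symm hbf.symm, hMx]
    exact hf.mem
  have hgb : φ g ≠ b := fun heq => hs.not_mem hb (heq ▸ hgy)
  have hgc' : φ g ≠ c := color_ne_of_missing hc hwg
  refine (hs'.not_mem_path' hS hf2 hg ?_ hwx hMw).1 (by rwa [hMx])
  rw [swap_of_ne hgc' hgb]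
  exact (mem_missing_swap_of_ne hgc' hgb).2 hgy

/-- A chain in a colour missing at `x` and a colour whose edge at `y` leaves the triangle. -/
theorem State.reachable_of_leaving (hS : Setting ends k d ε) (hs : State ends k (n + 10) φ e x y)
    (hf : Fan ends k φ f x y z) (ha : a ∈ missing ends k φ x) (haf : a ≠ φ f)
    (hω : 1 ≤ ω ∧ ω ≤ k) (hh : ends h = s(y, w)) (hhω : φ h = ω) (hwz : w ≠ z) :
    (kempe ends φ a ω).Reachable x y := by
  by_contra hr
  have hωf : φ f ≠ ω := fun heq => hwz
    (hs.proper.end_eq hf.link hh (missing_pos hf.mem) (heq.trans hhω.symm)).symm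
  have hf' : Fan ends k (kempeSwap ends φ x a ω) f x y z := by
    refine ⟨hf.link, ?_⟩
    rw [swap_of_ne haf.symm hωf]
    exact (mem_missing_swap_of_ne haf.symm hωf).2 hf.mem
  -- Otherwise the exchange at `x` makes `ω` missing there and does not touch `h`, so `h` would be a
  -- fan edge leading elsewhere than `f`.
  refine hwz ((hs.swap x (mem_missing.1 ha).1 hω).fan_unique hS (f := h) ⟨hh, ?_⟩ hf')
  rw [swap_of_not_reachable (u := y) (by simp [hh]) hr, hhω]
  exact mem_missing_swap hω (by rfl) ha

/-- Apply `State.reachable_of_leaving` before and after the shift along `f`, with `f₂` and `g` as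
the respective fan edges. When neither `e` nor `f` is coloured, the first chain has lost only `f`
and still links `x` to `y` or `z`; the second has lost only `e` and links `z` to `y` or `x`. In
every case `x` and `z` are linked. -/
theorem State.reachable_avoiding (hS : Setting ends k d ε) (hs : State ends k (n + 12) φ e x y)
    (hf : Fan ends k φ f x y z) (hf₂ : Fan ends k φ f₂ x y z) (hff : φ f ≠ φ f₂)
    (hg : ends g = s(y, x)) (hgz : φ g ∈ missing ends k φ z) (hω : 1 ≤ ω ∧ ω ≤ k)
    (hh : ends h = s(y, w)) (hhω : φ h = ω) (hwz : w ≠ z) (hwx : w ≠ x) :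
    (kempe ends (Function.update φ f 0) (φ f) ω).Reachable x z := by
  have hgf : φ g ≠ φ f := (color_ne_of_missing hgz hf.right_mem).symm
  have hωf : ω ≠ φ f := by
    rintro rfl
    exact hwz (hs.proper.end_eq hf.link hh (missing_pos hf.mem) hhω.symm).symm
  have r1 := hs.reachable_of_leaving hS hf₂ hf.mem hff hω hh hhω hwz
  have hgψ := hs.shift_color hf (missing_pos hgz) hgf
  have r2 := (hs.shift hf).reachable_of_leaving hS (f := g) (z := x) (a := φ f) (ω := ω) (h := h)
    (w := w) ⟨hg, by rw [hgψ]; exact hs.mem_missing_shift hf hgz (Or.inl hgf)⟩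
    (hs.color_mem_missing_shift hS hf) (by rw [hgψ]; exact hgf.symm) hω hh
    (by rw [hs.shift_color hf (by omega) (by rwa [hhω]), hhω]) hwx
  have s1 := reachable_or_of_agree (φ := Function.update φ f 0)
    (fun g hgf => Function.update_of_ne hgf _ _) hf.link r1
  have s2 := reachable_or_of_agree (f := e) (φ := Function.update φ f 0)
    (fun g hge => (Function.update_of_ne hge _ _).symm) (hs.link.trans Sym2.eq_swap) r2
  rcases s2 with s2 | s2
  · rcases s1 with s1 | s1
    · exact s1.trans s2.symm
    · exact s1
  · exact s2.symm

omit [Finite V] [Finite E] in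
theorem Proper.update_zero (hp : Proper ends φ) (f : E) : Proper ends (Function.update φ f 0) := by
  intro g g' v hne hg hg' h0
  by_cases h1 : g = f
  · subst h1
    simp at h0
  · rw [Function.update_of_ne h1] at h0 ⊢
    by_cases h2 : g' = f
    · subst h2
      simpa using h0
    · rw [Function.update_of_ne h2]
      exact hp g g' v hne hg hg' h0

omit [Finite V] [Finite E] in
theorem misses_update_zero (hp : Proper ends φ) (hv : v ∈ ends g) (hc : φ g ≠ 0) :
    Misses ends (Function.update φ g 0) (φ g) v := by
  intro g' hg'
  by_cases h : g' = g
  · subst h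
    rw [Function.update_self]
    exact hc.symm
  · rw [Function.update_of_ne h]
    exact fun heq => h (hp.eq hg' hv (heq ▸ hc) heq)

/-- This is `State.reachable_avoiding` after the shift along `f`, where `g` and `e` are two fan
edges at `y` leading to `x`. Neither `e` nor `f` has the colour `φ g` or `ω` before or after the
shift, so the chain is already present in `φ`. -/
theorem State.reachable_avoiding_shift (hS : Setting ends k d ε)
    (hs : State ends k (n + 14) φ e x y)
    (hf : Fan ends k φ f x y z) (hf₂ : Fan ends k φ f₂ x y z) (hff : φ f ≠ φ f₂)
    (hg : ends g = s(y, x)) (hgz : φ g ∈ missing ends k φ z) (hω : 1 ≤ ω ∧ ω ≤ k)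
    (hh : ends h = s(y, w)) (hhω : φ h = ω) (hwz : w ≠ z) (hwx : w ≠ x) :
    (kempe ends (Function.update φ g 0) (φ g) ω).Reachable z x := by
  have hgf : φ g ≠ φ f := (color_ne_of_missing hgz hf.right_mem).symm
  have hωf : ω ≠ φ f := by
    rintro rfl
    exact hwz (hs.proper.end_eq hf.link hh (missing_pos hf.mem) hhω.symm).symm
  have hgψ := hs.shift_color hf (missing_pos hgz) hgf
  have hg' : Fan ends k (shiftColor φ e f) g z y x :=
    ⟨hg, by rw [hgψ]; exact hs.mem_missing_shift hf hgz (Or.inl hgf)⟩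
  have hf₂ψ := hs.shift_color hf (missing_pos hf₂.mem) hff.symm
  have hr := (hs.shift hf).reachable_avoiding hS hg' (hs.shift_fan hS hf)
    (by rw [hgψ, shift_left]; exact hgf) (g := f₂) hf₂.link
    (by rw [hf₂ψ]; exact hs.mem_missing_shift hf hf₂.mem (Or.inl hff.symm)) hω hh
    (by rw [hs.shift_color hf (by omega) (by rwa [hhω]), hhω]) hwx hwz
  rw [hgψ] at hr
  refine hr.mono (kempe_mono fun g' hc => ?_)
  by_cases h1 : g' = g
  · subst h1
    simp
  · rw [Function.update_of_ne h1] at hc ⊢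
    rw [Function.update_of_ne h1]
    by_cases h2 : g' = e
    · subst h2
      rw [shift_left] at hc
      exact absurd hc (not_or.2 ⟨hgf.symm, hωf.symm⟩)
    · by_cases h3 : g' = f
      · subst h3
        rw [shift_right h2] at hc
        have := missing_pos hgz
        omega
      · exact (shift_of_ne h2 h3).symm

/-- With `g` uncoloured, all of `x`, `y`, `z` miss its former colour. The preceding lemma, used from
both ends of `e`, puts the three vertices on one chain of that colour and `ω`, which would have
three ends. -/
theorem State.leaving_absurd (hS : Setting ends k d ε) {f₂' h' : E} {w' : V}
    (hs : State ends k (n + 14) φ e x y)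
    (hf : Fan ends k φ f x y z) (hf₂ : Fan ends k φ f₂ x y z) (hff : φ f ≠ φ f₂)
    (hf' : Fan ends k φ f' y x z) (hf₂' : Fan ends k φ f₂' y x z) (hff' : φ f' ≠ φ f₂')
    (hg : ends g = s(y, x)) (hgz : φ g ∈ missing ends k φ z) (hω : 1 ≤ ω ∧ ω ≤ k)
    (hh : ends h = s(y, w)) (hhω : φ h = ω) (hwz : w ≠ z) (hwx : w ≠ x)
    (hh' : ends h' = s(x, w')) (hhω' : φ h' = ω) (hwz' : w' ≠ z) (hwy' : w' ≠ y) : False := by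
  have r1 := hs.reachable_avoiding_shift hS hf hf₂ hff hg hgz hω hh hhω hwz hwx
  have r2 := hs.symm.reachable_avoiding_shift hS hf' hf₂' hff' (hg.trans Sym2.eq_swap) hgz hω
    hh' hhω' hwz' hwy'
  have hg0 := missing_pos hgz
  refine three_ends (hs.proper.update_zero g) hg0 (by omega) hf.ne (hS.ne hf.link).symm
    (hS.ne hs.link) (Or.inl ?_) (Or.inl (misses_update_zero hs.proper (by simp [hg]) hg0))
    (Or.inl (misses_update_zero hs.proper (by simp [hg]) hg0)) r1 r2
  intro g' hg'
  by_cases h1 : g' = g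
  · subst h1
    rw [Function.update_self]
    exact hg0.symm
  · rw [Function.update_of_ne h1]
    exact color_ne_of_missing hgz hg'

/-- The number of edges between `x` and `y`. -/
noncomputable def mult (ends : E → Sym2 V) (x y : V) : ℕ := {e | ends e = s(x, y)}.ncard

omit [Finite V] [Finite E] [DecidableEq E] in
theorem mult_comm : mult ends x y = mult ends y x := by
  simp only [mult, Sym2.eq_swap]

omit [Finite V] [DecidableEq E] in
theorem card_le_mult (S : Finset ℕ) (h : ∀ c ∈ S, ∃ g, ends g = s(x, y) ∧ φ g = c) :
    S.card ≤ mult ends x y := by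
  rw [← Set.ncard_coe_finset]
  refine (Set.ncard_le_ncard (t := φ '' {g | ends g = s(x, y)}) ?_ (Set.toFinite _)).trans
    (Set.ncard_image_le (Set.toFinite _))
  intro c hc
  obtain ⟨g, hg, hgc⟩ := h c hc
  exact ⟨g, hg, hgc⟩

/-- Three vertices that span the exceptional multigraph. -/
def FatTriangle (ends : E → Sym2 V) (d ε : ℕ) : Prop :=
  ∃ x y z, x ≠ y ∧ y ≠ z ∧ x ≠ z ∧ d + ε ≤ mult ends x y ∧ d ≤ mult ends y z ∧ d ≤ mult ends x z

/-- If some edge is uncoloured and a bounded number of moves is of no use, there is a fat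
triangle. -/
theorem State.fatTriangle (hS : Setting ends k d ε) (hs : State ends k 14 φ e x y) :
    FatTriangle ends d ε := by
  obtain ⟨a, ha, -⟩ := hS.exists_ne hs 0
  have hxy := hS.ne hs.link
  have ha1 := (mem_missing.1 ha).1
  obtain ⟨f, z, hfl, rfl⟩ := exists_edge_of_not_missing ha1.1 ha1.2 (hs.not_mem ha)
  have hf : Fan ends k φ f x y z := ⟨hfl, ha⟩
  have hyz := hS.ne hfl
  have hxz := hf.ne.symm
  have hX : ∀ c ∈ missing ends k φ x, ∃ g, ends g = s(y, z) ∧ φ g = c := by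
    intro c hc
    have hc1 := (mem_missing.1 hc).1
    obtain ⟨g, w, hg, rfl⟩ := exists_edge_of_not_missing hc1.1 hc1.2 (hs.not_mem hc)
    obtain rfl := hs.fan_unique hS hf ⟨hg, hc⟩
    exact ⟨g, hg, rfl⟩
  have hY : ∀ c ∈ missing ends k φ y, ∃ g, ends g = s(x, z) ∧ φ g = c := by
    intro c hc
    have hc1 := (mem_missing.1 hc).1
    obtain ⟨g, w, hg, rfl⟩ := exists_edge_of_not_missing hc1.1 hc1.2 (hs.symm.not_mem hc)
    obtain rfl := hs.fan_eq_opposite hS hf ⟨hg, hc⟩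
    exact ⟨g, hg, rfl⟩
  have hZ : ∀ c ∈ missing ends k φ z, ∃ g, ends g = s(y, x) ∧ φ g = c := by
    intro c hc
    have hc1 := (mem_missing.1 hc).1
    obtain ⟨g, w, hg, rfl⟩ := exists_edge_of_not_missing hc1.1 hc1.2 (hs.not_mem_right hS hf hc)
    obtain rfl := hs.second_fan hS hf hg hc
    exact ⟨g, hg, rfl⟩
  -- The colour 0 accounts for `e` itself and compensates for the weaker bound d - 1 at `z`.
  have hZ0 : ∀ c ∈ insert 0 (missing ends k φ z), ∃ g, ends g = s(y, x) ∧ φ g = c := by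
    intro c hc
    rcases Finset.mem_insert.1 hc with rfl | hc
    · exact ⟨e, hs.link.trans Sym2.eq_swap, hs.zero⟩
    · exact hZ c hc
  have h0 : 0 ∉ missing ends k φ z := fun h => missing_pos h rfl
  have cX := card_le_mult _ hX
  have cY := card_le_mult _ hY
  have cZ := card_le_mult _ hZ0
  rw [Finset.card_insert_of_notMem h0, mult_comm] at cZ
  have lX := hS.le_card_left hs
  have lY := hS.le_card_right hs
  have lZ := hS.le_card (φ := φ) z
  have hk := hS.colors
  have hd := hS.two_le
  have hε := hS.parity
  have fXY : d + ε ≤ mult ends x y → FatTriangle ends d ε := fun h =>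
    ⟨x, y, z, hxy, hyz, hxz, h, by omega, by omega⟩
  have fYZ : d + ε ≤ mult ends y z → FatTriangle ends d ε := fun h =>
    ⟨y, z, x, hyz, hxz.symm, hxy.symm, h, by rw [mult_comm]; omega, by rw [mult_comm]; omega⟩
  have fXZ : d + ε ≤ mult ends x z → FatTriangle ends d ε := fun h =>
    ⟨x, z, y, hxz, hyz.symm, hxy, h, by rw [mult_comm]; omega, by omega⟩
  by_contra hno
  have nXY : ¬ d + ε ≤ mult ends x y := fun h => hno (fXY h)
  have nYZ : ¬ d + ε ≤ mult ends y z := fun h => hno (fYZ h)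
  have nXZ : ¬ d + ε ≤ mult ends x z := fun h => hno (fXZ h)
  -- For ε = 0 the assumptions already conflict. For ε = 1 all three multiplicities equal d, and the
  -- missing sets have at most d + d + (d - 1) < 3d = k colours in total.
  have hex : ∃ ω ∈ Finset.Icc 1 k,
      ω ∉ missing ends k φ x ∪ missing ends k φ y ∪ missing ends k φ z := by
    refine Finset.exists_mem_notMem_of_card_lt_card ?_
    have h1 := Finset.card_union_le (missing ends k φ x ∪ missing ends k φ y) (missing ends k φ z)
    have h2 := Finset.card_union_le (missing ends k φ x) (missing ends k φ y)
    rw [Nat.card_Icc]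
    omega
  obtain ⟨ω, hωk, hω⟩ := hex
  rw [Finset.mem_Icc] at hωk
  simp only [Finset.mem_union, not_or] at hω
  obtain ⟨⟨ωx, ωy⟩, ωz⟩ := hω
  -- The d edges of each pair are used up by the colours missing at the third vertex (and by `e` for
  -- the pair `x`, `y`), which leaves no room for `ω`.
  have addX : ∀ g, ends g = s(y, z) → φ g ≠ ω := by
    intro g hg hgω
    have := card_le_mult (ends := ends) (φ := φ) (x := y) (y := z) (insert ω (missing ends k φ x))
      (fun c hc => by
        rcases Finset.mem_insert.1 hc with rfl | hc
        · exact ⟨g, hg, hgω⟩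
        · exact hX c hc)
    rw [Finset.card_insert_of_notMem ωx] at this
    omega
  have addY : ∀ g, ends g = s(x, z) → φ g ≠ ω := by
    intro g hg hgω
    have := card_le_mult (ends := ends) (φ := φ) (x := x) (y := z) (insert ω (missing ends k φ y))
      (fun c hc => by
        rcases Finset.mem_insert.1 hc with rfl | hc
        · exact ⟨g, hg, hgω⟩
        · exact hY c hc)
    rw [Finset.card_insert_of_notMem ωy] at this
    omega
  have addZ : ∀ g, ends g = s(y, x) → φ g ≠ ω := by
    intro g hg hgω
    have := card_le_mult (ends := ends) (φ := φ) (x := y) (y := x)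
      (insert ω (insert 0 (missing ends k φ z)))
      (fun c hc => by
        rcases Finset.mem_insert.1 hc with rfl | hc
        · exact ⟨g, hg, hgω⟩
        · exact hZ0 c hc)
    have hω0 : ω ∉ insert 0 (missing ends k φ z) := by
      rw [Finset.mem_insert, not_or]
      exact ⟨by omega, ωz⟩
    rw [Finset.card_insert_of_notMem hω0, Finset.card_insert_of_notMem h0, mult_comm] at this
    omega
  obtain ⟨h, w, hh, hhω⟩ := exists_edge_of_not_missing hωk.1 hωk.2 ωy
  obtain ⟨h', w', hh', hhω'⟩ := exists_edge_of_not_missing hωk.1 hωk.2 ωx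
  obtain ⟨c₂, hc₂, hne₂⟩ := hS.exists_ne hs (φ f)
  obtain ⟨f₂, hf₂, rfl⟩ := hX c₂ hc₂
  obtain ⟨c', hc', -⟩ := hS.exists_ne hs.symm 0
  obtain ⟨f', hf', rfl⟩ := hY c' hc'
  obtain ⟨c₂', hc₂', hne₂'⟩ := hS.exists_ne hs.symm (φ f')
  obtain ⟨f₂', hf₂', rfl⟩ := hY c₂' hc₂'
  obtain ⟨c, hc⟩ := hS.exists_missing (φ := φ) z
  obtain ⟨g, hg, rfl⟩ := hZ c hc
  refine hs.leaving_absurd hS (n := 0) hf ⟨hf₂, hc₂⟩ hne₂.symm ⟨hf', hc'⟩ ⟨hf₂', hc₂'⟩ hne₂'.symm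
    hg hc hωk hh hhω ?_ ?_ hh' hhω' ?_ ?_
  · rintro rfl
    exact addX h hh hhω
  · rintro rfl
    exact addZ h hh hhω
  · rintro rfl
    exact addY h' hh' hhω'
  · rintro rfl
    exact addZ h' (hh'.trans Sym2.eq_swap) hhω'

end Triangle

/-! ### Polynomial-time functions -/

/-- `p` computes `y` from `x` in at most `T` steps. -/
def Runs (p : Prog) (x y : Val) (T : ℕ) : Prop := ∃ t ≤ T, Run p x y t

theorem Runs.mono {p : Prog} {x y : Val} {S T : ℕ} (h : Runs p x y S) (hST : S ≤ T) :
    Runs p x y T :=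
  let ⟨t, ht, hr⟩ := h
  ⟨t, ht.trans hST, hr⟩

theorem Runs.pair {p q : Prog} {x y z : Val} {S T : ℕ} (hp : Runs p x y S) (hq : Runs q x z T) :
    Runs (.pair p q) x (.cons y z) (S + T + 1) :=
  let ⟨_, hs, hr⟩ := hp
  let ⟨_, ht, hr'⟩ := hq
  ⟨_, by omega, .pair hr hr'⟩

theorem Runs.seq {p q : Prog} {x y z : Val} {S T : ℕ} (hp : Runs p x y S) (hq : Runs q y z T) :
    Runs (.seq p q) x z (S + T + 1) :=
  let ⟨_, hs, hr⟩ := hp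
  let ⟨_, ht, hr'⟩ := hq
  ⟨_, by omega, .seq hr hr'⟩

theorem Runs.id (x : Val) : Runs .id x x 1 := ⟨1, le_rfl, .id x⟩

theorem Runs.nil (x : Val) : Runs .nil x .nil 1 := ⟨1, le_rfl, .nil x⟩

theorem Runs.fst (x y : Val) : Runs .fst (.cons x y) x 1 := ⟨1, le_rfl, .fst_cons x y⟩

theorem Runs.snd (x y : Val) : Runs .snd (.cons x y) y 1 := ⟨1, le_rfl, .snd_cons x y⟩

/-- The number of nodes of a tree. -/
def Val.size : Val → ℕ
  | .nil => 1
  | .cons x y => x.size + y.size + 1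

/-- Types whose elements are represented by trees. -/
class Enc (α : Type) where
  /-- the representation -/
  enc : α → Val

open Enc

/-- The size of the representation. -/
def esize {α : Type} [Enc α] (a : α) : ℕ := (enc a).size

instance : Enc ℕ := ⟨encodeNat⟩

instance : Enc Unit := ⟨fun _ => .nil⟩

instance : Enc Bool := ⟨fun b => cond b (.cons .nil .nil) .nil⟩

instance {α β : Type} [Enc α] [Enc β] : Enc (α × β) := ⟨fun p => .cons (enc p.1) (enc p.2)⟩

instance {α : Type} [Enc α] : Enc (List α) := ⟨fun l => encodeList (l.map enc)⟩

section

variable {α β γ σ : Type} [Enc α] [Enc β] [Enc γ] [Enc σ]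

theorem enc_pair (a : α) (b : β) : enc (a, b) = .cons (enc a) (enc b) := rfl

theorem esize_pair (a : α) (b : β) : esize (a, b) = esize a + esize b + 1 := rfl

theorem enc_cons (a : α) (l : List α) : enc (a :: l) = .cons (enc a) (enc l) := rfl

theorem esize_nil : esize ([] : List α) = 1 := rfl

theorem esize_cons (a : α) (l : List α) : esize (a :: l) = esize a + esize l + 1 := rfl

theorem esize_nat (n : ℕ) : esize n = 2 * n + 1 := by
  induction n with
  | zero => rfl
  | succ n ih =>
    have : esize (n + 1) = 1 + esize n + 1 := rfl
    omega

theorem esize_bool_le (b : Bool) : esize b ≤ 3 := by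
  cases b <;> decide

theorem esize_append (l l' : List α) : esize (l ++ l') + 1 = esize l + esize l' := by
  induction l with
  | nil => simp [esize_nil, add_comm]
  | cons a l ih =>
    rw [List.cons_append, esize_cons, esize_cons]
    omega

theorem length_le_esize (l : List α) : l.length + 1 ≤ esize l := by
  induction l with
  | nil => simp [esize_nil]
  | cons a l ih =>
    rw [List.length_cons, esize_cons]
    omega

theorem esize_le_of_mem {l : List α} {a : α} (h : a ∈ l) : esize a ≤ esize l := by
  induction l with
  | nil => simp at h
  | cons b l ih =>
    rw [esize_cons]
    rcases List.mem_cons.1 h with rfl | h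
    · omega
    · have := ih h
      omega

theorem esize_le_of_sublist {l l' : List α} (h : l.Sublist l') : esize l ≤ esize l' := by
  induction h with
  | slnil => rfl
  | cons a _ ih => rw [esize_cons]; omega
  | cons_cons a _ ih => rw [esize_cons, esize_cons]; omega

theorem esize_le_of_forall {l : List α} {B : ℕ} (h : ∀ a ∈ l, esize a ≤ B) :
    esize l ≤ l.length * (B + 1) + 1 := by
  induction l with
  | nil => simp [esize_nil]
  | cons a l ih =>
    have h1 := ih fun b hb => h b (List.mem_cons_of_mem _ hb)
    have h2 := h a List.mem_cons_self
    rw [esize_cons, List.length_cons, add_mul]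
    omega

theorem esize_reverse (l : List α) : esize l.reverse = esize l := by
  induction l with
  | nil => rfl
  | cons a l ih =>
    have := esize_append l.reverse [a]
    rw [List.reverse_cons, esize_cons]
    rw [esize_cons, esize_nil] at this
    omega

theorem eval_mono (p : Polynomial ℕ) {m n : ℕ} (h : m ≤ n) : p.eval m ≤ p.eval n := by
  rw [Polynomial.eval_eq_sum_range, Polynomial.eval_eq_sum_range]
  exact Finset.sum_le_sum fun i _ => Nat.mul_le_mul_left _ (Nat.pow_le_pow_left h i)

/-- `f` is computed by a program in polynomial time, with results of polynomial size. -/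
def PT (f : α → β) : Prop :=
  ∃ (p : Prog) (T B : Polynomial ℕ), ∀ a,
    Runs p (enc a) (enc (f a)) (T.eval (esize a)) ∧ esize (f a) ≤ B.eval (esize a)

/-- Programs see only trees, so functions with equal encodings are interchangeable even if their
types differ. -/
theorem PT.of_enc_eq {f : α → β} {g : α → γ} (hg : PT g) (h : ∀ a, enc (f a) = enc (g a)) :
    PT f := by
  obtain ⟨p, T, B, hp⟩ := hg
  refine ⟨p, T, B, fun a => ?_⟩
  rw [show esize (f a) = esize (g a) from congrArg Val.size (h a), h a]
  exact hp a

theorem PT.size_le {f : α → β} (hf : PT f) :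
    ∃ B : Polynomial ℕ, ∀ a, esize (f a) ≤ B.eval (esize a) :=
  let ⟨_, _, B, hB⟩ := hf
  ⟨B, fun a => (hB a).2⟩

theorem PT.id : PT (fun a : α => a) :=
  ⟨.id, 1, .X, fun a => ⟨(Runs.id _).mono (by simp), by simp⟩⟩

theorem PT.comp {g : β → γ} {f : α → β} (hg : PT g) (hf : PT f) : PT fun a => g (f a) := by
  obtain ⟨p, T, B, hp⟩ := hf
  obtain ⟨q, S, C, hq⟩ := hg
  refine ⟨.seq p q, T + S.comp B + 1, C.comp B, fun a => ⟨?_, ?_⟩⟩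
  · refine ((hp a).1.seq (hq (f a)).1).mono ?_
    have := eval_mono S (hp a).2
    simp only [Polynomial.eval_add, Polynomial.eval_comp, Polynomial.eval_one]
    omega
  · rw [Polynomial.eval_comp]
    exact (hq _).2.trans (eval_mono C (hp a).2)

theorem PT.pair {f : α → β} {g : α → γ} (hf : PT f) (hg : PT g) : PT fun a => (f a, g a) := by
  obtain ⟨p, T, B, hp⟩ := hf
  obtain ⟨q, S, C, hq⟩ := hg
  refine ⟨.pair p q, T + S + 1, B + C + 1, fun a => ⟨?_, ?_⟩⟩
  · rw [enc_pair]
    simpa using (hp a).1.pair (hq a).1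
  · have h1 := (hp a).2
    have h2 := (hq a).2
    simp only [Polynomial.eval_add, Polynomial.eval_one, esize_pair]
    omega

theorem PT.fst {f : α → β × γ} (hf : PT f) : PT fun a => (f a).1 := by
  refine PT.comp (g := fun p : β × γ => p.1) ⟨.fst, 1, .X, fun a => ⟨?_, ?_⟩⟩ hf
  · exact (Runs.fst _ _).mono (by simp)
  · have : esize a = esize a.1 + esize a.2 + 1 := rfl
    simp only [Polynomial.eval_X]
    omega

theorem PT.snd {f : α → β × γ} (hf : PT f) : PT fun a => (f a).2 := by
  refine PT.comp (g := fun p : β × γ => p.2) ⟨.snd, 1, .X, fun a => ⟨?_, ?_⟩⟩ hf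
  · exact (Runs.snd _ _).mono (by simp)
  · have : esize a = esize a.1 + esize a.2 + 1 := rfl
    simp only [Polynomial.eval_X]
    omega

theorem exists_const_prog (v : Val) : ∃ p T, ∀ x, Runs p x v T := by
  induction v with
  | nil => exact ⟨.nil, 1, Runs.nil⟩
  | cons u v hu hv =>
    obtain ⟨p, S, hp⟩ := hu
    obtain ⟨q, T, hq⟩ := hv
    exact ⟨.pair p q, _, fun x => (hp x).pair (hq x)⟩

theorem PT.const (b : β) : PT fun _ : α => b := by
  obtain ⟨p, T, hp⟩ := exists_const_prog (enc b)
  exact ⟨p, .C T, .C (esize b), fun a => ⟨by simpa using hp _, by simp⟩⟩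

theorem PT.ite {c : α → Bool} {f g : α → β} (hc : PT c) (hf : PT f) (hg : PT g) :
    PT fun a => if c a then f a else g a := by
  obtain ⟨r, R, D, hr⟩ := hc
  obtain ⟨p, T, B, hp⟩ := hf
  obtain ⟨q, S, C, hq⟩ := hg
  refine ⟨.ite r p q, R + T + S + 1, B + C, fun a => ?_⟩
  simp only [Polynomial.eval_add, Polynomial.eval_one]
  obtain ⟨⟨s, hs, hrs⟩, -⟩ := hr a
  cases h : c a with
  | true =>
    rw [h] at hrs
    obtain ⟨⟨t, ht, hrt⟩, hB⟩ := hp a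
    exact ⟨⟨_, by omega, .ite_true hrs hrt⟩, by simp only [if_true]; omega⟩
  | false =>
    rw [h] at hrs
    obtain ⟨⟨t, ht, hrt⟩, hB⟩ := hq a
    exact ⟨⟨_, by omega, .ite_false hrs hrt⟩, by simp only [Bool.false_eq_true, if_false]; omega⟩

/-! #### Loops over lists -/

/-- The loop test of `foldProg`. -/
def foldTest : Prog := .seq .snd .snd

/-- The loop body of `foldProg`. -/
def foldBody (ps : Prog) : Prog :=
  .pair .fst (.pair
    (.seq (.pair .fst (.pair (.seq .snd .fst) (.seq (.seq .snd .snd) .fst))) ps)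
    (.seq (.seq .snd .snd) .snd))

/-- A program for `List.foldl`. -/
def foldProg (pl pinit ps : Prog) : Prog :=
  .seq (.pair .id (.pair pinit pl)) (.seq (.loop foldTest (foldBody ps)) (.seq .snd .fst))

/-- The loop state holds a fixed context, the accumulator and the remaining list. The time bound for
the step is required only at accumulators that actually occur; the constants 40 are slack for the
overhead of the loop. -/
theorem runs_loop {ps : Prog} {A : Val} {T : ℕ} {step : σ → β → σ} (l : List β) (s : σ)
    (h : ∀ l₁ b, l₁ ++ [b] <+: l →
      Runs ps (.cons A (.cons (enc (l₁.foldl step s)) (enc b)))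
        (enc (step (l₁.foldl step s) b)) T) :
    Runs (.loop foldTest (foldBody ps)) (.cons A (.cons (enc s) (enc l)))
      (.cons A (.cons (enc (l.foldl step s)) .nil)) (l.length * (T + 40) + 40) := by
  induction l generalizing s with
  | nil =>
    obtain ⟨t, ht, hr⟩ := (Runs.snd A (.cons (enc s) .nil)).seq (Runs.snd (enc s) .nil)
    exact ⟨_, by simp only [List.length_nil]; omega, .loop_done hr⟩
  | cons b l ih =>
    have htest : Runs (.seq .snd .snd) (.cons A (.cons (enc s) (enc (b :: l))))
        (.cons (enc b) (enc l)) 3 := (Runs.snd _ _).seq (Runs.snd _ _)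
    have hstep := h [] b (by simp)
    have hbody : Runs (foldBody ps) (.cons A (.cons (enc s) (enc (b :: l))))
        (.cons A (.cons (enc (step s b)) (enc l))) (T + 30) :=
      ((Runs.fst _ _).pair (((((Runs.fst _ _).pair (((Runs.snd _ _).seq (Runs.fst _ _)).pair
        (htest.seq (Runs.fst _ _)))).seq hstep)).pair (htest.seq (Runs.snd _ _)))).mono (by omega)
    obtain ⟨t₁, ht₁, hr₁⟩ := htest
    obtain ⟨t₂, ht₂, hr₂⟩ := hbody
    obtain ⟨t₃, ht₃, hr₃⟩ := ih (step s b) fun l₁ b' hl =>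
      h (b :: l₁) b' (by simpa using hl)
    refine ⟨_, ?_, .loop_step hr₁ hr₂ hr₃⟩
    rw [List.length_cons, add_mul]
    omega

/-- Iterating a polynomial-time step may blow up the accumulator. The bound `B`, required after
every prefix, excludes this and bounds the input of each step. -/
theorem PT.foldl {f : α → List β} {init : α → σ} {step : α → σ → β → σ} (hf : PT f)
    (hi : PT init) (hs : PT fun p : α × (σ × β) => step p.1 p.2.1 p.2.2) (B : Polynomial ℕ)
    (hB : ∀ a l, l <+: f a → esize (l.foldl (step a) (init a)) ≤ B.eval (esize a)) :
    PT fun a => (f a).foldl (step a) (init a) := by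
  obtain ⟨pl, Tl, Bl, hl⟩ := hf
  obtain ⟨pinit, Ti, Bi, hi⟩ := hi
  obtain ⟨ps, Ts, Bs, hs⟩ := hs
  refine ⟨foldProg pl pinit ps,
    Tl + Ti + Bl * (Ts.comp (.X + B + Bl + 2) + 40) + 60, B, fun a => ⟨?_, hB a _ List.prefix_rfl⟩⟩
  have hloop := runs_loop (ps := ps) (A := enc a) (T := (Ts.comp (.X + B + Bl + 2)).eval (esize a))
    (step := step a) (f a) (init a) fun l₁ b hlb => by
      refine (hs (a, l₁.foldl (step a) (init a), b)).1.mono ?_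
      rw [Polynomial.eval_comp]
      refine eval_mono _ ?_
      have h1 := hB a l₁ ((List.prefix_append _ _).trans hlb)
      have h2 : esize b ≤ esize (f a) := esize_le_of_mem (hlb.subset (by simp))
      have h3 := (hl a).2
      simp only [Polynomial.eval_add, Polynomial.eval_X, Polynomial.eval_ofNat, esize_pair]
      omega
  refine (((Runs.id _).pair ((hi a).1.pair (hl a).1)).seq
    (hloop.seq ((Runs.snd _ _).seq (Runs.fst _ _)))).mono ?_
  have h1 : (f a).length ≤ Bl.eval (esize a) := by
    have := length_le_esize (f a)
    have := (hl a).2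
    omega
  have h2 := Nat.mul_le_mul_right ((Ts.comp (.X + B + Bl + 2)).eval (esize a) + 40) h1
  simp only [Polynomial.eval_add, Polynomial.eval_mul, Polynomial.eval_ofNat] at h2 ⊢
  omega

theorem PT.cons {f : α → β} {g : α → List β} (hf : PT f) (hg : PT g) : PT fun a => f a :: g a :=
  (hf.pair hg).of_enc_eq fun _ => rfl

omit [Enc β] in
theorem foldl_cons (l s : List β) : l.foldl (fun s b => b :: s) s = l.reverse ++ s := by
  induction l generalizing s with
  | nil => rfl
  | cons b l ih =>
    rw [List.foldl_cons, ih, List.reverse_cons, List.append_assoc, List.singleton_append]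

omit [Enc β] in
theorem foldr_cons (l s : List β) : l.foldr (fun b s => b :: s) s = l ++ s := by
  induction l with
  | nil => rfl
  | cons b l ih => rw [List.foldr_cons, ih, List.cons_append]

omit [Enc β] [Enc γ] in
theorem flatMap_eq_foldr (g : β → List γ) (l : List β) :
    l.flatMap g = l.foldr (fun b s => g b ++ s) [] := by
  induction l with
  | nil => rfl
  | cons b l ih => rw [List.foldr_cons, ← ih, List.flatMap_cons]

omit [Enc β] in
theorem any_eq_foldr (g : β → Bool) (l : List β) :
    l.any g = l.foldr (fun b s => g b || s) false := by
  induction l with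
  | nil => rfl
  | cons b l ih => rw [List.foldr_cons, ← ih, List.any_cons]

theorem PT.reverse {f : α → List β} (hf : PT f) : PT fun a => (f a).reverse := by
  have key : PT fun l : List β => l.foldl (fun s b => b :: s) [] :=
    PT.foldl (step := fun _ s b => b :: s) PT.id (PT.const _)
      ((PT.id.snd.snd).cons PT.id.snd.fst) .X fun l l' hl => by
        rw [Polynomial.eval_X, foldl_cons, List.append_nil, esize_reverse]
        exact esize_le_of_sublist hl.sublist
  simpa only [foldl_cons, List.append_nil] using key.comp hf

theorem PT.foldr {f : α → List β} {init : α → σ} {step : α → β → σ → σ} (hf : PT f)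
    (hi : PT init) (hs : PT fun p : α × (σ × β) => step p.1 p.2.2 p.2.1) (B : Polynomial ℕ)
    (hB : ∀ a (l : List β), l.Sublist (f a) →
      esize (l.foldr (step a) (init a)) ≤ B.eval (esize a)) :
    PT fun a => (f a).foldr (step a) (init a) := by
  simp only [List.foldr_eq_foldl_reverse] at hB ⊢
  refine PT.foldl (step := fun a s b => step a b s) hf.reverse hi hs B fun a l hl => ?_
  have := hB a l.reverse (by simpa using hl.sublist.reverse)
  rwa [List.reverse_reverse] at this

theorem PT.append {f g : α → List β} (hf : PT f) (hg : PT g) : PT fun a => f a ++ g a := by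
  have key : PT fun p : List β × List β => p.1.foldr (fun b s => b :: s) p.2 :=
    PT.foldr (step := fun _ b s => b :: s) PT.id.fst PT.id.snd
      ((PT.id.snd.snd).cons PT.id.snd.fst) .X fun p l hl => by
        rw [Polynomial.eval_X, foldr_cons]
        have h1 := esize_append l p.2
        have h2 := esize_le_of_sublist hl
        have h3 : esize p = esize p.1 + esize p.2 + 1 := rfl
        omega
  have := key.comp (hf.pair hg)
  simpa only [foldr_cons] using this

omit [Enc α] in
theorem esize_flatMap_le {l : List α} {g : α → List β} {B : ℕ} (h : ∀ a ∈ l, esize (g a) ≤ B) :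
    esize (l.flatMap g) ≤ l.length * B + 1 := by
  induction l with
  | nil => simp [esize_nil]
  | cons a l ih =>
    have h1 := ih fun b hb => h b (List.mem_cons_of_mem _ hb)
    have h2 := h a List.mem_cons_self
    have h3 := esize_append (g a) (l.flatMap g)
    rw [List.flatMap_cons, List.length_cons, add_mul]
    omega

theorem PT.flatMap {f : α → List β} {g : α → β → List γ} (hf : PT f)
    (hg : PT fun p : α × β => g p.1 p.2) : PT fun a => (f a).flatMap (g a) := by
  obtain ⟨Bf, hf'⟩ := hf.size_le
  obtain ⟨Bg, hg'⟩ := hg.size_le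
  have key : PT fun a => (f a).foldr (fun b s => g a b ++ s) [] :=
    PT.foldr (step := fun a b s => g a b ++ s) hf (PT.const _)
      ((hg.comp (PT.id.fst.pair PT.id.snd.snd)).append PT.id.snd.fst)
      (Bf * Bg.comp (.X + Bf + 1) + 1) fun a l hl => by
        rw [← flatMap_eq_foldr]
        have h1 : esize (l.flatMap (g a)) ≤
            l.length * Bg.eval (esize a + Bf.eval (esize a) + 1) + 1 :=
          esize_flatMap_le fun b hb => (hg' (a, b)).trans (eval_mono _ (by
            have := (esize_le_of_mem (hl.subset hb)).trans (hf' a)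
            rw [esize_pair]
            omega))
        have h2 : l.length ≤ Bf.eval (esize a) := by
          have h3 := length_le_esize (f a)
          have h4 := hf' a
          have h5 := hl.length_le
          omega
        refine h1.trans ?_
        simp only [Polynomial.eval_add, Polynomial.eval_mul, Polynomial.eval_comp,
          Polynomial.eval_X, Polynomial.eval_one]
        exact Nat.add_le_add_right (Nat.mul_le_mul_right _ h2) 1
  simpa only [← flatMap_eq_foldr] using key

theorem PT.map {f : α → List β} {g : α → β → γ} (hf : PT f)
    (hg : PT fun p : α × β => g p.1 p.2) : PT fun a => (f a).map (g a) := by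
  have := PT.flatMap (g := fun a b => [g a b]) hf (hg.cons (PT.const []))
  simpa only [← List.map_eq_flatMap] using this

theorem PT.filter {f : α → List β} {g : α → β → Bool} (hf : PT f)
    (hg : PT fun p : α × β => g p.1 p.2) : PT fun a => (f a).filter (g a) := by
  have := PT.flatMap (g := fun a b => if g a b then [b] else []) hf
    (hg.ite (PT.id.snd.cons (PT.const [])) (PT.const []))
  have he : ∀ a, (f a).filter (g a) = (f a).flatMap fun b => if g a b then [b] else [] := by
    intro a
    induction f a with
    | nil => rfl
    | cons b l ih =>
      rw [List.filter_cons, List.flatMap_cons, ih]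
      split_ifs <;> rfl
  simpa only [he] using this

/-! #### Booleans and natural numbers -/

theorem PT.not {f : α → Bool} (hf : PT f) : PT fun a => !(f a) := by
  have := hf.ite (PT.const false) (PT.const true)
  refine this.of_enc_eq fun a => ?_
  cases f a <;> rfl

theorem PT.or {f g : α → Bool} (hf : PT f) (hg : PT g) : PT fun a => f a || g a := by
  have := hf.ite (PT.const true) hg
  refine this.of_enc_eq fun a => ?_
  cases f a <;> rfl

theorem PT.and {f g : α → Bool} (hf : PT f) (hg : PT g) : PT fun a => f a && g a := by
  have := hf.ite hg (PT.const false)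
  refine this.of_enc_eq fun a => ?_
  cases f a <;> rfl

theorem PT.any {f : α → List β} {g : α → β → Bool} (hf : PT f)
    (hg : PT fun p : α × β => g p.1 p.2) : PT fun a => (f a).any (g a) := by
  have := PT.foldr (step := fun a b s => g a b || s) hf (PT.const false)
    ((hg.comp (PT.id.fst.pair PT.id.snd.snd)).or PT.id.snd.fst) 3 fun a l _ => by
      simpa using esize_bool_le _
  simpa only [← any_eq_foldr] using this

theorem PT.all {f : α → List β} {g : α → β → Bool} (hf : PT f)
    (hg : PT fun p : α × β => g p.1 p.2) : PT fun a => (f a).all (g a) := by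
  have := (PT.any (g := fun a b => !(g a b)) hf hg.not).not
  simpa only [List.not_any_eq_all_not, Bool.not_not] using this

theorem PT.succ {f : α → ℕ} (hf : PT f) : PT fun a => f a + 1 :=
  ((PT.const ()).pair hf).of_enc_eq fun _ => rfl

/-- Unary numbers and lists of units are the same trees, so list programs serve for arithmetic and
for counted loops. -/
theorem enc_replicate (n : ℕ) : enc (List.replicate n ()) = enc n := by
  induction n with
  | zero => rfl
  | succ n ih =>
    rw [List.replicate_succ, enc_cons, ih]
    rfl

theorem PT.replicate {f : α → ℕ} (hf : PT f) : PT fun a => List.replicate (f a) () :=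
  hf.of_enc_eq fun _ => enc_replicate _

theorem PT.length {f : α → List β} (hf : PT f) : PT fun a => (f a).length := by
  refine (PT.map (g := fun _ _ => ()) hf (PT.const ())).of_enc_eq fun a => ?_
  rw [← enc_replicate, ← List.map_const']

theorem PT.pred {f : α → ℕ} (hf : PT f) : PT fun a => f a - 1 := by
  refine PT.comp (g := fun n : ℕ => n - 1) ⟨.snd, 1, .X, fun n => ⟨?_, ?_⟩⟩ hf
  · refine Runs.mono (S := 1) ?_ (by simp)
    cases n with
    | zero => exact ⟨1, le_rfl, .snd_nil⟩
    | succ n => exact Runs.snd .nil (encodeNat n)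
  · simp only [esize_nat, Polynomial.eval_X]
    omega

theorem PT.isZero {f : α → ℕ} (hf : PT f) : PT fun a => f a == 0 := by
  refine PT.comp (g := fun n : ℕ => n == 0) ?_ hf
  refine ⟨.ite .id .nil (.pair .nil .nil), 10, 3, fun n => ⟨?_, by simpa using esize_bool_le _⟩⟩
  rw [Polynomial.eval_ofNat]
  cases n with
  | zero => exact ⟨_, by omega, .ite_false (.id _) (.pair (.nil _) (.nil _))⟩
  | succ n => exact ⟨_, by omega, .ite_true (.id (.cons .nil (encodeNat n))) (.nil _)⟩

theorem PT.sub {f g : α → ℕ} (hf : PT f) (hg : PT g) : PT fun a => f a - g a := by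
  obtain ⟨B, hB⟩ := hf.size_le
  have he : ∀ (n : ℕ) (l : List Unit), l.foldl (fun s _ => s - 1) n = n - l.length := by
    intro n l
    induction l generalizing n with
    | nil => rfl
    | cons b l ih =>
      rw [List.foldl_cons, ih, List.length_cons]
      omega
  have := PT.foldl (step := fun _ s _ => s - 1) hg.replicate hf PT.id.snd.fst.pred B
    fun a l _ => by
      rw [he]
      refine le_trans ?_ (hB a)
      simp only [esize_nat]
      omega
  simpa only [he, List.length_replicate] using this

theorem PT.add {f g : α → ℕ} (hf : PT f) (hg : PT g) : PT fun a => f a + g a := by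
  have := (hf.replicate.append hg.replicate).length
  simpa using this

theorem PT.lt {f g : α → ℕ} (hf : PT f) (hg : PT g) : PT fun a => decide (f a < g a) := by
  have := (hf.succ.sub hg).isZero
  refine this.of_enc_eq fun a => congrArg _ ?_
  rw [Bool.eq_iff_iff]
  simp only [decide_eq_true_eq, beq_iff_eq]
  omega

theorem PT.beq {f g : α → ℕ} (hf : PT f) (hg : PT g) : PT fun a => f a == g a := by
  have := (hf.sub hg).isZero.and (hg.sub hf).isZero
  refine this.of_enc_eq fun a => congrArg _ ?_
  rw [Bool.eq_iff_iff]
  simp only [Bool.and_eq_true, beq_iff_eq]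
  omega

theorem PT.contains {f : α → List ℕ} {g : α → ℕ} (hf : PT f) (hg : PT g) :
    PT fun a => (f a).contains (g a) := by
  have := PT.any (g := fun a b => g a == b) hf ((hg.comp PT.id.fst).beq PT.id.snd)
  refine this.of_enc_eq fun a => congrArg _ ?_
  rw [List.contains_eq_any_beq]

theorem PT.range {f : α → ℕ} (hf : PT f) : PT fun a => List.range (f a) := by
  have he : ∀ l : List Unit, (l.foldr (fun _ s => s ++ [s.length]) []) = List.range l.length := by
    intro l
    induction l with
    | nil => rfl
    | cons b l ih =>
      rw [List.foldr_cons, ih, List.length_cons, List.range_succ, List.length_range]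
  obtain ⟨B, hB⟩ := hf.size_le
  have := PT.foldr (step := fun _ _ s => s ++ [s.length]) hf.replicate (PT.const [])
    (PT.id.snd.fst.append (PT.id.snd.fst.length.cons (PT.const []))) (B * (B + 1) + 1)
    fun a l hl => by
      rw [he]
      have h1 := hl.length_le
      rw [List.length_replicate] at h1
      have h2 := hB a
      rw [esize_nat] at h2
      have h3 := esize_le_of_forall (l := List.range l.length) (B := B.eval (esize a))
        fun b hb => by
          rw [List.mem_range] at hb
          rw [esize_nat]
          omega
      simp only [Polynomial.eval_add, Polynomial.eval_mul, Polynomial.eval_one]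
      rw [List.length_range] at h3
      have h4 := Nat.mul_le_mul_right (B.eval (esize a) + 1)
        (show l.length ≤ B.eval (esize a) by omega)
      omega
  simpa only [he, List.length_replicate] using this

end

/-! ### The algorithm -/

/-- An edge: its identifier, its two ends and its colour. -/
abbrev Item : Type := (ℕ × (ℕ × ℕ)) × ℕ

/-- Give colour `c` to the edge `i`. -/
def setAt (i c : ℕ) (l : List Item) : List Item :=
  l.map fun t => (t.1, if t.1.1 == i then c else t.2)

/-- Exchange `a` and `b`. -/
def swapNat (a b c : ℕ) : ℕ := if c == a then b else if c == b then a else c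

/-- Add to a set `R` of vertices its neighbours in the subgraph of the edges coloured `a` or `b`. -/
def grow (n a b : ℕ) (l : List Item) (R : List ℕ) : List ℕ :=
  (List.range n).filter fun w => R.contains w || l.any fun t =>
    (t.2 == a || t.2 == b) &&
      ((t.1.2.1 == w && R.contains t.1.2.2) || (t.1.2.2 == w && R.contains t.1.2.1))

/-- The vertices of the `a`-`b`-chain through `v`. -/
def chain (n a b v : ℕ) (l : List Item) : List ℕ :=
  (List.range n).foldl (fun R _ => grow n a b l R) [v]

/-- Exchange the colours `a` and `b` on the chain through `v`. -/
def swapAt (n a b v : ℕ) (l : List Item) : List Item :=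
  l.map fun t => (t.1, if (chain n a b v l).contains t.1.2.1 then swapNat a b t.2 else t.2)

/-- Test whether a colouring is proper. -/
def isProper (l : List Item) : Bool :=
  l.all fun s => l.all fun t => s.1.1 == t.1.1 || (s.2 == 0 || (!(s.2 == t.2) ||
    !(s.1.2.1 == t.1.2.1 || (s.1.2.1 == t.1.2.2 ||
      (s.1.2.2 == t.1.2.1 || s.1.2.2 == t.1.2.2)))))

/-- The number of uncoloured edges. -/
def numUncolored (l : List Item) : ℕ := (l.filter fun t => t.2 == 0).length

/-- The colourings obtained by at most one move. -/
def moves (n k : ℕ) (l : List Item) : List (List Item) :=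
  l :: ((l.flatMap fun t => (List.range (k + 1)).map fun c => setAt t.1.1 c l) ++
    (List.range n).flatMap fun v => (List.range (k + 1)).flatMap fun a =>
      (List.range (k + 1)).map fun b => swapAt n a b v l)

/-- The colourings obtained by at most one move from a colouring in a list. -/
def expand (n k : ℕ) (S : List (List Item)) : List (List Item) :=
  S.flatMap fun l => moves n k l

/-- Go through a list and keep the best entry. -/
def pick {σ : Type} (better : σ → σ → Bool) (l : List σ) (s : σ) : σ :=
  l.foldl (fun s t => if better s t then t else s) s

/-- The best proper colouring within fourteen moves. -/
def improve (n k : ℕ) (l : List Item) : List Item :=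
  pick (fun s t => isProper t && decide (numUncolored t < numUncolored s))
    ((expand n k)^[14] [l]) l

/-- The edge list with all edges uncoloured. -/
def initial (es : List (ℕ × ℕ)) : List Item :=
  es.foldr (fun uv s => ((s.length, uv), 0) :: s) []

/-- The maximum degree. -/
def maxDeg (n : ℕ) (es : List (ℕ × ℕ)) : ℕ :=
  pick (fun s t => decide (s < t))
    ((List.range n).map fun v => (es.filter fun p => p.1 == v || p.2 == v).length) 0

/-- One less than Shannon's bound. -/
def numColors (D : ℕ) : ℕ :=
  D + ((List.range D).filter fun j => decide (j + j + 1 < D)).length - 1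

/-- Colour the edges with `k` colours. -/
def colorAll (n k : ℕ) (es : List (ℕ × ℕ)) : List Item :=
  es.foldl (fun l _ => improve n k l) (initial es)

/-- The cyclic permutation of `{1, …, k}`. -/
def rotate (k c : ℕ) : ℕ := if c == k then 1 else c + 1

/-- The power `s` of the cyclic permutation. -/
def rotateBy (k s c : ℕ) : ℕ := (List.range s).foldl (fun c _ => rotate k c) c

/-- Rotate the colours and keep those that are at most `D`. -/
def window (D k s : ℕ) (l : List Item) : List ℕ :=
  l.map fun t => if decide (D < rotateBy k s t.2) then 0 else rotateBy k s t.2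

/-- The number of nonzero entries. -/
def numColored (o : List ℕ) : ℕ := (o.filter fun c => !(c == 0)).length

/-- The largest of the cyclic windows of `D` colour classes. -/
def selectColors (D k : ℕ) (l : List Item) : List ℕ :=
  pick (fun s t => decide (numColored s < numColored t))
    ((List.range k).map fun s => window D k s l) (window D k 0 l)

/-- The whole algorithm, for given maximum degree. -/
def solve (D n : ℕ) (es : List (ℕ × ℕ)) : List ℕ :=
  selectColors D (numColors D) (colorAll n (numColors D) es)

/-- The whole algorithm. -/
def algorithm (x : ℕ × List (ℕ × ℕ)) : List ℕ :=
  solve (maxDeg x.1 x.2) x.1 x.2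

/-! ### An invariant bounding the colourings met by the search -/

theorem pick_mem {σ : Type} (better : σ → σ → Bool) (l : List σ) (s : σ) :
    pick better l s = s ∨ pick better l s ∈ l := by
  induction l generalizing s with
  | nil => exact Or.inl rfl
  | cons t l ih =>
    have h : pick better (t :: l) s = pick better l (if better s t then t else s) := rfl
    rw [h]
    rcases ih (if better s t then t else s) with h' | h'
    · rw [h']
      split_ifs
      · exact Or.inr List.mem_cons_self
      · exact Or.inl rfl
    · exact Or.inr (List.mem_cons_of_mem _ h')

/-- The edge list `L` with colours at most `k`. -/
def Shape (L : List (ℕ × (ℕ × ℕ))) (k : ℕ) (l : List Item) : Prop :=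
  l.map Prod.fst = L ∧ ∀ t ∈ l, t.2 ≤ k

theorem Shape.map {L : List (ℕ × (ℕ × ℕ))} {k : ℕ} {l : List Item} (h : Shape L k l)
    {g : Item → ℕ} (hg : ∀ t : Item, t.2 ≤ k → g t ≤ k) :
    Shape L k (l.map fun t => (t.1, g t)) := by
  refine ⟨?_, ?_⟩
  · rw [List.map_map]
    exact h.1
  · intro t ht
    obtain ⟨s, hs, rfl⟩ := List.mem_map.1 ht
    exact hg s (h.2 s hs)

theorem swapNat_le {a b c k : ℕ} (ha : a ≤ k) (hb : b ≤ k) (hc : c ≤ k) : swapNat a b c ≤ k := by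
  unfold swapNat
  split_ifs <;> assumption

theorem Shape.moves {L : List (ℕ × (ℕ × ℕ))} {n k : ℕ} {l l' : List Item} (h : Shape L k l)
    (hl : l' ∈ moves n k l) : Shape L k l' := by
  simp only [MaxECS.moves, List.mem_cons, List.mem_append, List.mem_flatMap, List.mem_map,
    List.mem_range] at hl
  rcases hl with rfl | ⟨t, -, c, hc, rfl⟩ | ⟨v, -, a, ha, b, hb, rfl⟩
  · exact h
  · refine h.map fun t ht => ?_
    split_ifs <;> omega
  · refine h.map fun t ht => ?_
    split_ifs
    · exact swapNat_le (by omega) (by omega) ht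
    · exact ht

theorem Shape.search {L : List (ℕ × (ℕ × ℕ))} {n k j : ℕ} {S : List (List Item)}
    (h : ∀ l ∈ S, Shape L k l) : ∀ l ∈ (expand n k)^[j] S, Shape L k l := by
  induction j generalizing S with
  | zero => exact h
  | succ j ih =>
    refine ih (S := expand n k S) fun l hl => ?_
    obtain ⟨l₀, hl₀, hl⟩ := List.mem_flatMap.1 hl
    exact (h l₀ hl₀).moves hl

theorem Shape.improve {L : List (ℕ × (ℕ × ℕ))} {n k : ℕ} {l : List Item} (h : Shape L k l) :
    Shape L k (improve n k l) := by
  rcases pick_mem (fun s t => isProper t && decide (numUncolored t < numUncolored s))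
    ((expand n k)^[14] [l]) l with h' | h'
  · rw [MaxECS.improve, h']
    exact h
  · exact Shape.search (S := [l]) (by simpa using h) _ h'

theorem Shape.initial (es : List (ℕ × ℕ)) (k : ℕ) :
    Shape ((initial es).map Prod.fst) k (initial es) := by
  refine ⟨rfl, ?_⟩
  induction es with
  | nil => simp [MaxECS.initial]
  | cons p es ih =>
    intro t ht
    rcases List.mem_cons.1 ht with rfl | ht
    · exact Nat.zero_le _
    · exact ih t ht

theorem Shape.foldl {L : List (ℕ × (ℕ × ℕ))} {n k : ℕ} {l : List Item} (h : Shape L k l)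
    (es : List (ℕ × ℕ)) : Shape L k (es.foldl (fun l _ => MaxECS.improve n k l) l) := by
  induction es generalizing l with
  | nil => exact h
  | cons p es ih =>
    rw [List.foldl_cons]
    exact ih h.improve

/-! ### Polynomial running time of the subroutines -/

section

variable {α σ : Type} [Enc α] [Enc σ]

theorem PT.pick {better : α → σ → σ → Bool} {f : α → List σ} {s : α → σ} (hf : PT f) (hs : PT s)
    (hb : PT fun p : α × (σ × σ) => better p.1 p.2.1 p.2.2) :
    PT fun a => pick (better a) (f a) (s a) := by
  obtain ⟨B, hB⟩ := hf.size_le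
  obtain ⟨C, hC⟩ := hs.size_le
  refine PT.foldl (step := fun a s t => if better a s t then t else s) hf hs
    (hb.ite PT.id.snd.snd PT.id.snd.fst) (B + C) fun a l hl => ?_
  rw [Polynomial.eval_add]
  have h1 := hB a
  have h2 := hC a
  rcases pick_mem (better a) l (s a) with h | h
  · have : esize (l.foldl (fun s t => if better a s t then t else s) (s a)) = esize (s a) :=
      congrArg esize h
    omega
  · have := esize_le_of_mem (hl.subset h)
    exact this.trans (by omega)

/-- The exponent is fixed outside the program: each round composes the size bound with a polynomial,
so the degree depends on `n`. This is why the search depth must be an absolute constant. -/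
theorem PT.iterate {step : α → σ → σ} {s : α → σ} (hs : PT s)
    (hstep : PT fun p : α × σ => step p.1 p.2) (n : ℕ) : PT fun a => (step a)^[n] (s a) := by
  induction n with
  | zero => exact hs
  | succ n ih =>
    simp only [Function.iterate_succ_apply']
    exact hstep.comp (PT.id.pair ih)

variable {f g h i j : α → ℕ} {l : α → List Item}

theorem PT.setAt (hf : PT f) (hg : PT g) (hl : PT l) : PT fun a => setAt (f a) (g a) (l a) := by
  unfold MaxECS.setAt
  refine PT.map hl (PT.id.snd.fst.pair (PT.ite ?_ ?_ PT.id.snd.snd))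
  · exact PT.beq PT.id.snd.fst.fst (hf.comp PT.id.fst)
  · exact hg.comp PT.id.fst

theorem PT.swapNat (hf : PT f) (hg : PT g) (hh : PT h) :
    PT fun a => swapNat (f a) (g a) (h a) := by
  unfold MaxECS.swapNat
  exact (hh.beq hf).ite hg ((hh.beq hg).ite hf hh)

theorem PT.grow {R : α → List ℕ} (hf : PT f) (hg : PT g) (hh : PT h) (hl : PT l) (hR : PT R) :
    PT fun a => grow (f a) (g a) (h a) (l a) (R a) := by
  unfold MaxECS.grow
  refine PT.filter hf.range (PT.or ((hR.comp PT.id.fst).contains PT.id.snd)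
    (PT.any (hl.comp PT.id.fst) ?_))
  have hR' : PT fun p : (α × ℕ) × Item => R p.1.1 := hR.comp PT.id.fst.fst
  refine PT.and (PT.or ?_ ?_) (PT.or (PT.and ?_ (hR'.contains PT.id.snd.fst.snd.snd))
    (PT.and ?_ (hR'.contains PT.id.snd.fst.snd.fst)))
  · exact PT.id.snd.snd.beq (hg.comp PT.id.fst.fst)
  · exact PT.id.snd.snd.beq (hh.comp PT.id.fst.fst)
  · exact PT.id.snd.fst.snd.fst.beq PT.id.fst.snd
  · exact PT.id.snd.fst.snd.snd.beq PT.id.fst.snd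

theorem PT.chain (hf : PT f) (hg : PT g) (hh : PT h) (hi : PT i) (hl : PT l) :
    PT fun a => chain (f a) (g a) (h a) (i a) (l a) := by
  unfold MaxECS.chain
  obtain ⟨B, hB⟩ := hf.range.size_le
  obtain ⟨C, hC⟩ := hi.size_le
  refine PT.foldl (step := fun a R _ => MaxECS.grow (f a) (g a) (h a) (l a) R) hf.range
    (hi.cons (PT.const [])) ?_ (B + C + 2) fun a L _ => ?_
  · exact PT.grow (hf.comp PT.id.fst) (hg.comp PT.id.fst) (hh.comp PT.id.fst) (hl.comp PT.id.fst)
      PT.id.snd.fst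
  · simp only [Polynomial.eval_add, Polynomial.eval_ofNat]
    have h1 := hB a
    have h2 := hC a
    -- Every round filters `List.range`, so after the first one the set is never larger than that
    -- list.
    rcases List.eq_nil_or_concat L with rfl | ⟨L', x, rfl⟩
    · rw [List.foldl_nil, esize_cons, esize_nil]
      omega
    · rw [List.concat_eq_append, List.foldl_append, List.foldl_cons, List.foldl_nil]
      have := esize_le_of_sublist (List.filter_sublist (l := List.range (f a))
        (p := fun w => (L'.foldl (fun R _ => MaxECS.grow (f a) (g a) (h a) (l a) R) [i a]).contains w
          || (l a).any fun t => (t.2 == g a || t.2 == h a) && ((t.1.2.1 == w &&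
            (L'.foldl (fun R _ => MaxECS.grow (f a) (g a) (h a) (l a) R) [i a]).contains t.1.2.2) ||
          (t.1.2.2 == w &&
            (L'.foldl (fun R _ => MaxECS.grow (f a) (g a) (h a) (l a) R) [i a]).contains t.1.2.1))))
      exact this.trans (by omega)

theorem PT.swapAt (hf : PT f) (hg : PT g) (hh : PT h) (hi : PT i) (hl : PT l) :
    PT fun a => swapAt (f a) (g a) (h a) (i a) (l a) := by
  unfold MaxECS.swapAt
  refine PT.map hl (PT.id.snd.fst.pair (PT.ite (PT.contains ?_ PT.id.snd.fst.snd.fst)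
    (PT.swapNat (hg.comp PT.id.fst) (hh.comp PT.id.fst) PT.id.snd.snd) PT.id.snd.snd))
  exact (PT.chain hf hg hh hi hl).comp PT.id.fst

theorem PT.isProper (hl : PT l) : PT fun a => isProper (l a) := by
  unfold MaxECS.isProper
  refine PT.all hl (PT.all (hl.comp PT.id.fst) ?_)
  have hs : PT fun p : (α × Item) × Item => p.1.2 := PT.id.fst.snd
  have ht : PT fun p : (α × Item) × Item => p.2 := PT.id.snd
  exact (hs.fst.fst.beq ht.fst.fst).or (hs.snd.isZero.or ((hs.snd.beq ht.snd).not.or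
    ((hs.fst.snd.fst.beq ht.fst.snd.fst).or ((hs.fst.snd.fst.beq ht.fst.snd.snd).or
      ((hs.fst.snd.snd.beq ht.fst.snd.fst).or (hs.fst.snd.snd.beq ht.fst.snd.snd)))).not))

theorem PT.numUncolored (hl : PT l) : PT fun a => numUncolored (l a) := by
  unfold MaxECS.numUncolored
  exact (PT.filter hl PT.id.snd.snd.isZero).length

theorem PT.moves (hf : PT f) (hg : PT g) (hl : PT l) : PT fun a => moves (f a) (g a) (l a) := by
  unfold MaxECS.moves
  refine hl.cons (PT.append (PT.flatMap hl (PT.map (hg.comp PT.id.fst).succ.range ?_))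
    (PT.flatMap hf.range (PT.flatMap (hg.comp PT.id.fst).succ.range
      (PT.map (hg.comp PT.id.fst.fst).succ.range ?_))))
  · exact PT.setAt PT.id.fst.snd.fst.fst PT.id.snd (hl.comp PT.id.fst.fst)
  · exact PT.swapAt (hf.comp PT.id.fst.fst.fst) PT.id.fst.snd PT.id.snd PT.id.fst.fst.snd
      (hl.comp PT.id.fst.fst.fst)

theorem PT.improve (hf : PT f) (hg : PT g) (hl : PT l) :
    PT fun a => improve (f a) (g a) (l a) := by
  unfold MaxECS.improve
  refine PT.pick (PT.iterate (step := fun a => expand (f a) (g a)) (hl.cons (PT.const [])) ?_ 14) hl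
    (PT.and (PT.isProper PT.id.snd.snd)
      (PT.lt (PT.numUncolored PT.id.snd.snd) (PT.numUncolored PT.id.snd.fst)))
  exact PT.flatMap PT.id.snd (PT.moves (hf.comp PT.id.fst.fst) (hg.comp PT.id.fst.fst) PT.id.snd)

theorem PT.initial {es : α → List (ℕ × ℕ)} (hes : PT es) : PT fun a => initial (es a) := by
  unfold MaxECS.initial
  obtain ⟨B, hB⟩ := hes.size_le
  refine PT.foldr (step := fun _ uv s => ((s.length, uv), 0) :: s) hes (PT.const []) ?_
    (B * (B * 3 + 10) + 1) fun a L hL => ?_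
  · exact ((PT.id.snd.fst.length.pair PT.id.snd.snd).pair (PT.const 0)).cons PT.id.snd.fst
  · have key : ∀ L : List (ℕ × ℕ), (MaxECS.initial L).length = L.length ∧
        ∀ t ∈ MaxECS.initial L, t.1.1 ≤ L.length ∧ t.1.2 ∈ L ∧ t.2 = 0 := by
      intro L
      induction L with
      | nil => simp [MaxECS.initial]
      | cons p L ih =>
        have he : MaxECS.initial (p :: L) =
          (((MaxECS.initial L).length, p), 0) :: MaxECS.initial L := rfl
        rw [he]
        refine ⟨by simp [ih.1], fun t ht => ?_⟩
        rcases List.mem_cons.1 ht with rfl | ht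
        · exact ⟨by simp [ih.1], by simp, rfl⟩
        · obtain ⟨h1, h2, h3⟩ := ih.2 t ht
          exact ⟨by simp only [List.length_cons]; omega, List.mem_cons_of_mem _ h2, h3⟩
    have hlen := (length_le_esize L).trans ((esize_le_of_sublist hL).trans (hB a))
    have h1 := esize_le_of_forall (l := MaxECS.initial L) (B := 3 * B.eval (esize a) + 9)
      fun t ht => by
        obtain ⟨h1, h2, h3⟩ := (key L).2 t ht
        have h4 := (esize_le_of_mem (hL.subset h2)).trans (hB a)
        have h5 : esize t = (esize t.1.1 + esize t.1.2 + 1) + esize t.2 + 1 := rfl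
        rw [h5, esize_nat, esize_nat]
        omega
    rw [(key L).1] at h1
    refine h1.trans ?_
    simp only [Polynomial.eval_add, Polynomial.eval_mul, Polynomial.eval_ofNat,
      Polynomial.eval_one]
    exact Nat.add_le_add_right (Nat.mul_le_mul (by omega) (by omega)) 1

theorem PT.colorAll {es : α → List (ℕ × ℕ)} (hf : PT f) (hg : PT g) (hes : PT es) :
    PT fun a => colorAll (f a) (g a) (es a) := by
  unfold MaxECS.colorAll
  obtain ⟨B, hB⟩ := (PT.map (g := fun _ t => t.1) (PT.initial hes) PT.id.snd.fst).size_le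
  obtain ⟨C, hC⟩ := hg.size_le
  refine PT.foldl (step := fun a l _ => MaxECS.improve (f a) (g a) l) hes (PT.initial hes)
    (PT.improve (hf.comp PT.id.fst) (hg.comp PT.id.fst) PT.id.snd.fst) (B * (B + C + 2) + 1)
    fun a L _ => ?_
  -- Every accumulator has the original edge list and colours at most `g a`, so its size does not
  -- grow with the number of rounds.
  have hsh := (Shape.initial (es a) (g a)).foldl (n := f a) L
  set r := L.foldl (fun l _ => MaxECS.improve (f a) (g a) l) (MaxECS.initial (es a))
  have h1 : esize ((MaxECS.initial (es a)).map Prod.fst) ≤ B.eval (esize a) := hB a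
  have h2 := hC a
  have h3 := length_le_esize ((MaxECS.initial (es a)).map Prod.fst)
  have hlen : r.length = ((MaxECS.initial (es a)).map Prod.fst).length := by
    rw [← hsh.1, List.length_map]
  have h4 := esize_le_of_forall (l := r) (B := B.eval (esize a) + C.eval (esize a) + 1)
    fun t ht => by
      have h5 : t.1 ∈ (MaxECS.initial (es a)).map Prod.fst := by
        rw [← hsh.1]
        exact List.mem_map_of_mem ht
      have h6 := (esize_le_of_mem h5).trans h1
      have h7 := hsh.2 t ht
      have h8 : esize t = esize t.1 + esize t.2 + 1 := rfl
      rw [esize_nat] at h2 h8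
      omega
  refine h4.trans ?_
  simp only [Polynomial.eval_add, Polynomial.eval_mul, Polynomial.eval_ofNat, Polynomial.eval_one]
  exact Nat.add_le_add_right (Nat.mul_le_mul (by omega) (by omega)) 1

theorem rotate_le (k c : ℕ) : rotate k c ≤ c + 1 := by
  unfold rotate
  split_ifs <;> omega

theorem rotateBy_le (k s c : ℕ) : rotateBy k s c ≤ c + s + 1 := by
  have key : ∀ L : List ℕ, L.foldl (fun c _ => rotate k c) c ≤ c + L.length + 1 := by
    intro L
    induction L using List.reverseRecOn with
    | nil => simp
    | append_singleton L x ih =>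
      rw [List.foldl_append, List.foldl_cons, List.foldl_nil, List.length_append,
        List.length_singleton]
      exact (rotate_le _ _).trans (by omega)
  have h := key (List.range s)
  rwa [List.length_range] at h

theorem PT.rotateBy (hf : PT f) (hg : PT g) (hh : PT h) :
    PT fun a => rotateBy (f a) (g a) (h a) := by
  unfold MaxECS.rotateBy
  obtain ⟨B, hB⟩ := hg.size_le
  obtain ⟨C, hC⟩ := hh.size_le
  refine PT.foldl (step := fun a c _ => rotate (f a) c) hg.range hh ?_ (B * 2 + C * 2 + 3)
    fun a L hL => ?_
  · unfold rotate
    exact PT.ite (PT.beq PT.id.snd.fst (hf.comp PT.id.fst)) (PT.const 1) PT.id.snd.fst.succ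
  · have h1 := rotateBy_le (f a) L.length (h a)
    have h2 : MaxECS.rotateBy (f a) L.length (h a) = L.foldl (fun c _ => rotate (f a) c) (h a) := by
      have : L = List.range L.length := by
        rw [List.prefix_iff_eq_take] at hL
        rw [hL]
        simp [List.take_range]
      conv_rhs => rw [this]
      rfl
    have h3 := hL.length_le
    have h4 := hB a
    have h5 := hC a
    rw [List.length_range] at h3
    rw [esize_nat] at h4 h5
    rw [esize_nat, ← h2]
    simp only [Polynomial.eval_add, Polynomial.eval_mul, Polynomial.eval_ofNat]
    omega

theorem PT.window (hf : PT f) (hg : PT g) (hh : PT h) (hl : PT l) :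
    PT fun a => window (f a) (g a) (h a) (l a) := by
  unfold MaxECS.window
  have hr : PT fun p : α × Item => MaxECS.rotateBy (g p.1) (h p.1) p.2.2 :=
    PT.rotateBy (hg.comp PT.id.fst) (hh.comp PT.id.fst) PT.id.snd.snd
  exact PT.map hl (PT.ite (PT.lt (hf.comp PT.id.fst) hr) (PT.const 0) hr)

theorem PT.numColored {o : α → List ℕ} (ho : PT o) : PT fun a => numColored (o a) := by
  unfold MaxECS.numColored
  exact (PT.filter ho PT.id.snd.isZero.not).length

theorem PT.selectColors (hf : PT f) (hg : PT g) (hl : PT l) :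
    PT fun a => selectColors (f a) (g a) (l a) := by
  unfold MaxECS.selectColors
  refine PT.pick (PT.map hg.range ?_) (PT.window hf hg (PT.const 0) hl)
    (PT.lt (PT.numColored PT.id.snd.fst) (PT.numColored PT.id.snd.snd))
  exact PT.window (hf.comp PT.id.fst) (hg.comp PT.id.fst) PT.id.snd (hl.comp PT.id.fst)

theorem PT.maxDeg {es : α → List (ℕ × ℕ)} (hf : PT f) (hes : PT es) :
    PT fun a => maxDeg (f a) (es a) := by
  unfold MaxECS.maxDeg
  refine PT.pick (PT.map hf.range (PT.length (PT.filter (hes.comp PT.id.fst) ?_))) (PT.const 0)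
    (PT.lt PT.id.snd.fst PT.id.snd.snd)
  exact PT.or (PT.beq PT.id.snd.fst PT.id.fst.snd) (PT.beq PT.id.snd.snd PT.id.fst.snd)

theorem PT.numColors (hf : PT f) : PT fun a => numColors (f a) := by
  unfold MaxECS.numColors
  exact (hf.add (PT.length (PT.filter hf.range
    (PT.lt (PT.id.snd.add PT.id.snd).succ (hf.comp PT.id.fst))))).pred

end

theorem PT.algorithm : PT MaxECS.algorithm := by
  have hn : PT fun x : ℕ × List (ℕ × ℕ) => x.1 := PT.id.fst
  have hes : PT fun x : ℕ × List (ℕ × ℕ) => x.2 := PT.id.snd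
  have hD := PT.maxDeg hn hes
  exact PT.selectColors hD hD.numColors (PT.colorAll hn hD.numColors hes)

/-! ### Correctness of the algorithm -/

/-- The unordered pairs of ends. -/
def symEnds {n m : ℕ} (ends : Fin m → Fin n × Fin n) (e : Fin m) : Sym2 (Fin n) :=
  s((ends e).1, (ends e).2)

/-- The edge list of a colouring. -/
def items {n m : ℕ} (ends : Fin m → Fin n × Fin n) (φ : Fin m → ℕ) : List Item :=
  List.ofFn fun e => (((e.rev : ℕ), (((ends e).1 : ℕ), ((ends e).2 : ℕ))), φ e)

section

variable {n m k : ℕ} {ends : Fin m → Fin n × Fin n} {φ ψ : Fin m → ℕ}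

theorem mem_items {t : Item} : t ∈ items ends φ ↔
    ∃ e : Fin m, (((e.rev : ℕ), (((ends e).1 : ℕ), ((ends e).2 : ℕ))), φ e) = t := by
  simp [items, List.mem_ofFn]

theorem setAt_items (i : Fin m) (c : ℕ) :
    setAt (i.rev : ℕ) c (items ends φ) = items ends (Function.update φ i c) := by
  simp only [setAt, items, List.map_ofFn]
  congr 1
  funext e
  by_cases h : e = i
  · subst h
    simp
  · have : ((e.rev : ℕ) == (i.rev : ℕ)) = false := by
      rw [beq_eq_false_iff_ne]
      intro h'
      exact h (Fin.rev_injective (Fin.ext h'))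
    simp only [Function.comp_apply, this, Function.update_of_ne h, Bool.false_eq_true, if_false]

theorem mem_grow {a b : ℕ} {R : List ℕ} {u : Fin n} :
    (u : ℕ) ∈ grow n a b (items ends φ) R ↔
      (u : ℕ) ∈ R ∨ ∃ w : Fin n, (w : ℕ) ∈ R ∧ (kempe (symEnds ends) φ a b).Adj w u := by
  simp only [grow, List.mem_filter, List.mem_range, u.2, true_and, Bool.or_eq_true,
    List.contains_iff_mem, List.any_eq_true, mem_items, Bool.and_eq_true, beq_iff_eq]
  constructor
  · rintro (h | ⟨_, ⟨e, rfl⟩, hc, ⟨h1, h2⟩ | ⟨h1, h2⟩⟩)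
    · exact Or.inl h
    · by_cases hne : (ends e).2 = u
      · exact Or.inl (hne ▸ h2)
      · refine Or.inr ⟨_, h2, hne, e, ?_, hc⟩
        rw [symEnds, Fin.ext h1, Sym2.eq_swap]
    · by_cases hne : (ends e).1 = u
      · exact Or.inl (hne ▸ h2)
      · refine Or.inr ⟨_, h2, hne, e, ?_, hc⟩
        rw [symEnds, Fin.ext h1]
  · rintro (h | ⟨w, hw, -, e, he, hc⟩)
    · exact Or.inl h
    · refine Or.inr ⟨_, ⟨e, rfl⟩, hc, ?_⟩
      rw [symEnds, Sym2.eq_iff] at he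
      rcases he with ⟨h1, h2⟩ | ⟨h1, h2⟩
      · exact Or.inr ⟨congrArg Fin.val h2, h1 ▸ hw⟩
      · exact Or.inl ⟨congrArg Fin.val h1, h2 ▸ hw⟩

/-- A path has fewer than `n` edges, so `n` rounds of growth reach the whole component. -/
theorem mem_chain {a b : ℕ} {v u : Fin n} :
    (u : ℕ) ∈ chain n a b v (items ends φ) ↔ (kempe (symEnds ends) φ a b).Reachable v u := by
  rw [chain, List.foldl_const, List.length_range]
  constructor
  · have key : ∀ j (u : Fin n), (u : ℕ) ∈ (grow n a b (items ends φ))^[j] [(v : ℕ)] →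
        (kempe (symEnds ends) φ a b).Reachable v u := by
      intro j
      induction j with
      | zero =>
        intro u hu
        rw [Function.iterate_zero, id, List.mem_singleton] at hu
        rw [Fin.ext hu]
      | succ j ih =>
        intro u hu
        rw [Function.iterate_succ_apply', mem_grow] at hu
        rcases hu with hu | ⟨w, hw, hadj⟩
        · exact ih u hu
        · exact (ih w hw).trans hadj.reachable
    exact key n u
  · have key : ∀ j (u : Fin n) (W : (kempe (symEnds ends) φ a b).Walk u v), W.length ≤ j →
        (u : ℕ) ∈ (grow n a b (items ends φ))^[j] [(v : ℕ)] := by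
      intro j
      induction j with
      | zero =>
        intro u W hW
        cases W with
        | nil => simp
        | cons _ _ => simp at hW
      | succ j ih =>
        intro u W hW
        rw [Function.iterate_succ_apply', mem_grow]
        cases W with
        | nil => exact Or.inl (ih _ .nil (Nat.zero_le _))
        | cons hadj W =>
          rw [SimpleGraph.Walk.length_cons] at hW
          exact Or.inr ⟨_, ih _ W (by omega), hadj.symm⟩
    intro hr
    obtain ⟨W, hW⟩ := hr.symm.exists_isPath
    have := hW.length_lt
    rw [Fintype.card_fin] at this
    exact key n u W this.le

/-- Testing the first end suffices: an edge coloured `a` or `b` has both ends in one component, and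
`swapNat` fixes all other colours. -/
theorem swapAt_items (a b : ℕ) (v : Fin n) :
    swapAt n a b v (items ends φ) = items ends (kempeSwap (symEnds ends) φ v a b) := by
  have hm : swapAt n a b v (items ends φ) = List.ofFn fun e : Fin m =>
      (((e.rev : ℕ), (((ends e).1 : ℕ), ((ends e).2 : ℕ))),
        if (chain n a b v (items ends φ)).contains (ends e).1 then swapNat a b (φ e) else φ e) := by
    rw [swapAt]
    conv_lhs => rw [items]
    rw [List.map_ofFn]
    rfl
  rw [hm]
  refine congrArg List.ofFn (funext fun e => ?_)
  have he : (ends e).1 ∈ symEnds ends e := by simp [symEnds]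
  have hsw : swapNat a b (φ e) = Equiv.swap a b (φ e) := by
    simp only [swapNat, Equiv.swap_apply_def, beq_iff_eq]
  congr 1
  by_cases hr : (kempe (symEnds ends) φ a b).Reachable v (ends e).1
  · rw [swap_of_reachable he hr, if_pos (List.contains_iff_mem.2 (mem_chain.2 hr)), hsw]
  · rw [swap_of_not_reachable he hr, if_neg]
    exact fun h => hr (mem_chain.1 (List.contains_iff_mem.1 h))

theorem isProper_items : isProper (items ends φ) = true ↔ Proper (symEnds ends) φ := by
  simp only [isProper, List.all_eq_true, mem_items, forall_exists_index, forall_apply_eq_imp_iff,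
    Bool.or_eq_true, beq_iff_eq, Bool.not_eq_true', Bool.or_eq_false_iff, beq_eq_false_iff_ne]
  constructor
  · intro h e f v hne he hf h0 heq
    rcases h e f with h | h | h | h
    · exact hne (Fin.rev_injective (Fin.ext h))
    · exact h0 h
    · exact h heq
    · simp only [Ne, Fin.val_inj] at h
      rw [symEnds, Sym2.mem_iff] at he hf
      rcases he with rfl | rfl <;> rcases hf with hf | hf <;> tauto
  · intro h e f
    by_cases hne : e = f
    · exact Or.inl (by rw [hne])
    by_cases h0 : φ e = 0
    · exact Or.inr (Or.inl h0)
    by_cases heq : φ e = φ f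
    · refine Or.inr (Or.inr (Or.inr ?_))
      have hv : ∀ v, v ∈ symEnds ends e → v ∉ symEnds ends f := fun v he hf =>
        h e f v hne he hf h0 heq
      have h1 := hv (ends e).1 (by simp [symEnds])
      have h2 := hv (ends e).2 (by simp [symEnds])
      simp only [symEnds, Sym2.mem_iff, not_or] at h1 h2
      simp only [Ne, Fin.val_inj]
      exact ⟨h1.1, h1.2, h2.1, h2.2⟩
    · exact Or.inr (Or.inr (Or.inl heq))

theorem length_filter_ofFn {α : Type*} (f : Fin m → α) (p : α → Bool) :
    ((List.ofFn f).filter p).length = {e | p (f e) = true}.ncard := by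
  classical
  have h : {e | p (f e) = true} = ((Finset.univ.filter fun e => p (f e) = true : Finset (Fin m)) :
      Set (Fin m)) := by
    ext e
    simp
  rw [h, Set.ncard_coe_finset, ← List.countP_eq_length_filter, List.ofFn_eq_map, List.countP_map,
    List.countP_eq_length_filter, Finset.card_filter, ← Fin.sum_ofFn]
  rw [← List.countP_eq_length_filter, List.ofFn_eq_map]
  induction List.finRange m with
  | nil => rfl
  | cons x l ih =>
    rw [List.countP_cons, ih, List.map_cons, List.sum_cons, add_comm]
    rfl

theorem numUncolored_items : numUncolored (items ends φ) = uncolored φ := by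
  rw [numUncolored, items, length_filter_ofFn, uncolored]
  simp

theorem exists_items_of_shape {l : List Item} {L : List (ℕ × (ℕ × ℕ))}
    (hL : L = (items ends φ).map Prod.fst) (h : Shape L k l) :
    ∃ ψ, l = items ends ψ ∧ ∀ e, ψ e ≤ k := by
  have hlen : l.length = m := by
    have := congrArg List.length (h.1.trans hL)
    simpa [items] using this
  obtain ⟨f, rfl⟩ : ∃ f : Fin m → Item, l = List.ofFn f := by
    subst hlen
    exact ⟨l.get, (List.ofFn_get l).symm⟩
  refine ⟨fun e => (f e).2, ?_, fun e => h.2 _ (List.mem_ofFn.2 ⟨e, rfl⟩)⟩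
  have h1 := h.1.trans hL
  rw [items, List.map_ofFn, List.map_ofFn] at h1
  have h2 := List.ofFn_injective h1
  exact congrArg List.ofFn (funext fun e => Prod.ext (congrFun h2 e) rfl)

theorem mem_moves_self {l : List Item} : l ∈ moves n k l := List.mem_cons_self

theorem mem_moves (h : Move (symEnds ends) k φ ψ) :
    items ends ψ ∈ moves n k (items ends φ) := by
  simp only [moves, List.mem_cons, List.mem_append, List.mem_flatMap, List.mem_map, List.mem_range]
  rcases h with ⟨e, c, hc, rfl⟩ | ⟨v, a, b, ha, hb, rfl⟩
  · exact Or.inr (Or.inl ⟨_, mem_items.2 ⟨e, rfl⟩, c, by omega, setAt_items e c⟩)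
  · exact Or.inr (Or.inr ⟨v, v.2, a, by omega, b, by omega, swapAt_items a b v⟩)

/-- Since `moves` also lists the unchanged colouring, the `j`-th expansion contains everything
reached in at most `j` moves. Its additional entries are harmless, as only proper ones are ever
compared. -/
theorem stuck_of_search {u j : ℕ} {S : List (List Item)} (hφ : items ends φ ∈ S)
    (h : ∀ ψ, items ends ψ ∈ (expand n k)^[j] S → Proper (symEnds ends) ψ → u ≤ uncolored ψ) :
    Stuck (symEnds ends) k u j φ := by
  induction j generalizing S φ with
  | zero => exact h φ hφ
  | succ j ih =>
    exact ⟨ih (S := expand n k S) (List.mem_flatMap.2 ⟨_, hφ, mem_moves_self⟩) h, fun ψ hψ =>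
      ih (S := expand n k S) (List.mem_flatMap.2 ⟨_, hφ, mem_moves hψ⟩) h⟩

theorem pick_min {σ : Type} (P : σ → Bool) (f : σ → ℕ) (l : List σ) (s : σ) :
    let r := pick (fun s t => P t && decide (f t < f s)) l s
    (r = s ∨ (r ∈ l ∧ P r = true)) ∧ f r ≤ f s ∧ ∀ t ∈ l, P t = true → f r ≤ f t := by
  induction l generalizing s with
  | nil => simp [pick]
  | cons t l ih =>
    have hr : pick (fun s t => P t && decide (f t < f s)) (t :: l) s =
      pick (fun s t => P t && decide (f t < f s)) l
        (if (P t && decide (f t < f s)) = true then t else s) := rfl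
    simp only [hr]
    have h := ih (if (P t && decide (f t < f s)) = true then t else s)
    simp only at h
    set r := pick (fun s t => P t && decide (f t < f s)) l
        (if (P t && decide (f t < f s)) = true then t else s)
    obtain ⟨h1, h2, h3⟩ := h
    by_cases hc : (P t && decide (f t < f s)) = true
    · rw [if_pos hc] at h1 h2
      rw [Bool.and_eq_true, decide_eq_true_eq] at hc
      refine ⟨?_, by omega, ?_⟩
      · rcases h1 with h1 | h1
        · rw [h1]
          exact Or.inr ⟨List.mem_cons_self, hc.1⟩
        · exact Or.inr ⟨List.mem_cons_of_mem _ h1.1, h1.2⟩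
      · intro t' ht' hP
        rcases List.mem_cons.1 ht' with rfl | ht'
        · exact h2
        · exact h3 t' ht' hP
    · rw [if_neg hc] at h1 h2
      rw [Bool.and_eq_true, decide_eq_true_eq, not_and, not_lt] at hc
      refine ⟨h1.imp_right fun h => ⟨List.mem_cons_of_mem _ h.1, h.2⟩, h2, ?_⟩
      intro t' ht' hP
      rcases List.mem_cons.1 ht' with rfl | ht'
      · exact h2.trans (hc hP)
      · exact h3 t' ht' hP

theorem improve_spec {d ε : ℕ} (hS : Setting (symEnds ends) k d ε)
    (hF : ¬ FatTriangle (symEnds ends) d ε) (hp : Proper (symEnds ends) φ) (hk : ∀ e, φ e ≤ k) :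
    ∃ ψ, improve n k (items ends φ) = items ends ψ ∧ Proper (symEnds ends) ψ ∧ (∀ e, ψ e ≤ k) ∧
      uncolored ψ ≤ uncolored φ - 1 := by
  have hsh : Shape ((items ends φ).map Prod.fst) k (items ends φ) := by
    refine ⟨rfl, fun t ht => ?_⟩
    obtain ⟨e, rfl⟩ := mem_items.1 ht
    exact hk e
  obtain ⟨ψ, hψ, hψk⟩ := exists_items_of_shape rfl (hsh.improve (n := n))
  have hpick := pick_min isProper numUncolored ((expand n k)^[14] [items ends φ]) (items ends φ)
  simp only at hpick
  rw [← improve, hψ, numUncolored_items, numUncolored_items] at hpick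
  obtain ⟨h1, h2, h3⟩ := hpick
  refine ⟨ψ, hψ, ?_, hψk, ?_⟩
  · rcases h1 with h1 | h1
    · rw [← isProper_items, h1, isProper_items]
      exact hp
    · exact isProper_items.1 h1.2
  · by_contra hlt
    have heq : uncolored ψ = uncolored φ := by omega
    have hpos : 0 < uncolored φ := by omega
    obtain ⟨e, he⟩ := (Set.ncard_pos (Set.toFinite _)).1 hpos
    -- If the best proper colouring found is no better than `φ`, then `φ` is stuck and has an
    -- uncoloured edge, which forces a fat triangle.
    have hst : Stuck (symEnds ends) k (uncolored φ) 14 φ := by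
      refine stuck_of_search (List.mem_singleton_self (items ends φ)) fun χ hχ hχp => ?_
      have := h3 _ hχ (isProper_items.2 hχp)
      rw [numUncolored_items] at this
      omega
    exact hF (State.fatTriangle hS ⟨hp, hk, he, rfl, hst⟩)

/-- The identifier of an edge is the number of edges after it in the list, hence `Fin.rev` in
`items`. -/
theorem initial_ofFn : initial (List.ofFn fun e => (((ends e).1 : ℕ), ((ends e).2 : ℕ))) =
    items ends fun _ => 0 := by
  have key : ∀ {m : ℕ} (f : Fin m → ℕ × ℕ),
      initial (List.ofFn f) = List.ofFn fun e => (((e.rev : ℕ), f e), 0) := by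
    intro m
    induction m with
    | zero => intro f; rfl
    | succ m ih =>
      intro f
      have h : initial (List.ofFn f) =
          (((initial (List.ofFn fun e => f e.succ)).length, f 0), 0) ::
            initial (List.ofFn fun e => f e.succ) := by
        rw [List.ofFn_succ]
        rfl
      rw [h, ih, List.length_ofFn, List.ofFn_succ]
      simp [Fin.rev_succ]
  exact key _

/-- Each round colours at least one more edge unless none is left, so one round per edge ends with
no uncoloured edge. -/
theorem colorAll_spec {d ε : ℕ} (hS : Setting (symEnds ends) k d ε)
    (hF : ¬ FatTriangle (symEnds ends) d ε) :
    ∃ ψ, colorAll n k (List.ofFn fun e => (((ends e).1 : ℕ), ((ends e).2 : ℕ))) = items ends ψ ∧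
      Proper (symEnds ends) ψ ∧ ∀ e, 1 ≤ ψ e ∧ ψ e ≤ k := by
  have key : ∀ (es : List (ℕ × ℕ)) (φ : Fin m → ℕ), Proper (symEnds ends) φ → (∀ e, φ e ≤ k) →
      ∃ ψ, es.foldl (fun l _ => improve n k l) (items ends φ) = items ends ψ ∧
        Proper (symEnds ends) ψ ∧ (∀ e, ψ e ≤ k) ∧ uncolored ψ ≤ uncolored φ - es.length := by
    intro es
    induction es with
    | nil => exact fun φ hp hk => ⟨φ, rfl, hp, hk, le_rfl⟩
    | cons p es ih =>
      intro φ hp hk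
      obtain ⟨χ, h1, h2, h3, h4⟩ := improve_spec hS hF hp hk
      obtain ⟨ψ, h5, h6, h7, h8⟩ := ih χ h2 h3
      refine ⟨ψ, ?_, h6, h7, ?_⟩
      · rw [List.foldl_cons, h1, h5]
      · rw [List.length_cons]
        omega
  obtain ⟨ψ, h1, h2, h3, h4⟩ := key (List.ofFn fun e => (((ends e).1 : ℕ), ((ends e).2 : ℕ)))
    (fun _ => 0) (fun _ _ _ _ _ _ h => absurd rfl h) fun _ => Nat.zero_le _
  refine ⟨ψ, ?_, h2, fun e => ⟨?_, h3 e⟩⟩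
  · rw [colorAll, initial_ofFn, h1]
  · have h5 : uncolored (fun _ : Fin m => 0) ≤ m := by
      have := Set.ncard_le_card {e : Fin m | (fun _ : Fin m => 0) e = 0}
      rwa [Nat.card_eq_fintype_card, Fintype.card_fin] at this
    rw [List.length_ofFn] at h4
    have h6 : uncolored ψ = 0 := by omega
    rw [uncolored, Set.ncard_eq_zero (Set.toFinite _)] at h6
    by_contra h7
    have : e ∈ {e | ψ e = 0} := by
      show ψ e = 0
      omega
    rw [h6] at this
    exact this

end

/-! ### Cyclic windows of colours -/

section Windows

theorem rotateBy_succ (k s c : ℕ) : rotateBy k (s + 1) c = rotate k (rotateBy k s c) := by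
  simp only [rotateBy, List.range_succ, List.foldl_append, List.foldl_cons, List.foldl_nil]

theorem rotateBy_eq {k c : ℕ} (h1 : 1 ≤ c) (hk : c ≤ k) (s : ℕ) :
    rotateBy k s c = (c - 1 + s) % k + 1 := by
  induction s with
  | zero =>
    rw [add_zero, Nat.mod_eq_of_lt (by omega)]
    simp only [rotateBy, List.range_zero, List.foldl_nil]
    omega
  | succ s ih =>
    rw [rotateBy_succ, ih, ← add_assoc]
    have h := Nat.mod_add_mod (c - 1 + s) k 1
    simp only [rotate, beq_iff_eq]
    split_ifs with hc
    · rw [hc, Nat.mod_self] at h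
      omega
    · have := Nat.mod_lt (c - 1 + s) (show k > 0 by omega)
      rw [Nat.mod_eq_of_lt (by omega)] at h
      omega

theorem rotateBy_inj {k c c' s : ℕ} (h1 : 1 ≤ c) (hk : c ≤ k) (h1' : 1 ≤ c') (hk' : c' ≤ k)
    (h : rotateBy k s c = rotateBy k s c') : c = c' := by
  rw [rotateBy_eq h1 hk, rotateBy_eq h1' hk', add_left_inj] at h
  have h2 : c - 1 ≡ c' - 1 [MOD k] := Nat.ModEq.add_right_cancel' s h
  have := h2.eq_of_lt_of_lt (by omega) (by omega)
  omega

/-- As `s` varies, `c - 1 + s` runs through `k` consecutive integers and meets each residue once;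
exactly `D` residues are below `D`. -/
theorem card_rotateBy_le {k c D : ℕ} (h1 : 1 ≤ c) (hk : c ≤ k) (hD : D ≤ k) :
    ((Finset.range k).filter fun s => rotateBy k s c ≤ D).card = D := by
  have hper : Function.Periodic (fun x => x % k < D) k := fun x => by simp
  have h := Nat.filter_Ico_card_eq_of_periodic (c - 1) k (fun x => x % k < D) hper
  rw [Nat.count_eq_card_filter_range] at h
  have h2 : (Finset.range k).filter (fun x => x % k < D) = Finset.range D := by
    ext x
    rw [Finset.mem_filter, Finset.mem_range, Finset.mem_range]
    constructor
    · rintro ⟨hx, h⟩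
      rwa [Nat.mod_eq_of_lt hx] at h
    · intro h
      have hx : x < k := by omega
      exact ⟨hx, by rwa [Nat.mod_eq_of_lt hx]⟩
  rw [h2, Finset.card_range] at h
  refine Eq.trans ?_ h
  refine Finset.card_bij (fun s _ => c - 1 + s) ?_ ?_ ?_
  · intro s hs
    rw [Finset.mem_filter, Finset.mem_range, rotateBy_eq h1 hk] at hs
    rw [Finset.mem_filter, Finset.mem_Ico]
    exact ⟨by omega, by omega⟩
  · intro s _ t _ hst
    omega
  · intro x hx
    rw [Finset.mem_filter, Finset.mem_Ico] at hx
    refine ⟨x - (c - 1), ?_, by omega⟩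
    rw [Finset.mem_filter, Finset.mem_range, rotateBy_eq h1 hk,
      show c - 1 + (x - (c - 1)) = x by omega]
    exact ⟨by omega, by omega⟩

/-- Double counting: every edge lies in exactly `D` of the `k` windows, so some window reaches the
average `D * m / k`. -/
theorem exists_window {m k D : ℕ} {φ : Fin m → ℕ} (hφ : ∀ e, 1 ≤ φ e ∧ φ e ≤ k) (hD : D ≤ k)
    (hk : 0 < k) : ∃ s < k, D * m ≤ k * {e | rotateBy k s (φ e) ≤ D}.ncard := by
  have hsum : ∑ s ∈ Finset.range k, {e | rotateBy k s (φ e) ≤ D}.ncard = m * D := by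
    have h1 : ∀ s, {e | rotateBy k s (φ e) ≤ D}.ncard =
        (Finset.univ.filter fun e => rotateBy k s (φ e) ≤ D).card := by
      intro s
      rw [← Set.ncard_coe_finset]
      simp
    simp only [h1, Finset.card_filter]
    rw [Finset.sum_comm]
    simp only [← Finset.card_filter]
    rw [Finset.sum_congr rfl fun e _ => card_rotateBy_le (hφ e).1 (hφ e).2 hD]
    simp
  have hne : (Finset.range k).Nonempty := ⟨0, Finset.mem_range.2 hk⟩
  obtain ⟨s, hs, h⟩ := Finset.exists_le_of_sum_le (s := Finset.range k) (f := fun _ => D * m)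
    (g := fun s => k * {e | rotateBy k s (φ e) ≤ D}.ncard) hne (by
      rw [Finset.sum_const, ← Finset.mul_sum, hsum]
      simp [mul_comm])
  exact ⟨s, Finset.mem_range.1 hs, h⟩

theorem pick_max {σ : Type} (f : σ → ℕ) (l : List σ) (s : σ) :
    f s ≤ f (pick (fun s t => decide (f s < f t)) l s) ∧
      ∀ t ∈ l, f t ≤ f (pick (fun s t => decide (f s < f t)) l s) := by
  induction l generalizing s with
  | nil => simp [pick]
  | cons t l ih =>
    have hr : pick (fun s t => decide (f s < f t)) (t :: l) s =
      pick (fun s t => decide (f s < f t)) l (if decide (f s < f t) = true then t else s) := rfl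
    rw [hr]
    obtain ⟨h1, h2⟩ := ih (if decide (f s < f t) = true then t else s)
    have h3 : f s ≤ f (if decide (f s < f t) = true then t else s) ∧
        f t ≤ f (if decide (f s < f t) = true then t else s) := by
      simp only [decide_eq_true_eq]
      split_ifs <;> omega
    refine ⟨h3.1.trans h1, fun t' ht' => ?_⟩
    rcases List.mem_cons.1 ht' with rfl | ht'
    · exact h3.2.trans h1
    · exact h2 t' ht'

variable {n m k D : ℕ} {ends : Fin m → Fin n × Fin n} {φ : Fin m → ℕ}

theorem window_items (s : ℕ) : window D k s (items ends φ) =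
    List.ofFn fun e => if D < rotateBy k s (φ e) then 0 else rotateBy k s (φ e) := by
  simp only [window, items, List.map_ofFn, decide_eq_true_eq]
  rfl

theorem one_le_rotateBy {c s : ℕ} (h1 : 1 ≤ c) (hk : c ≤ k) : 1 ≤ rotateBy k s c := by
  rw [rotateBy_eq h1 hk]
  omega

theorem numColored_window (hφ : ∀ e, 1 ≤ φ e ∧ φ e ≤ k) (s : ℕ) :
    numColored (window D k s (items ends φ)) = {e | rotateBy k s (φ e) ≤ D}.ncard := by
  rw [window_items, numColored, length_filter_ofFn]
  congr 1
  ext e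
  have := one_le_rotateBy (s := s) (hφ e).1 (hφ e).2
  simp only [Bool.not_eq_true', beq_eq_false_iff_ne, Set.mem_ofPred_eq]
  split_ifs <;> omega

theorem selectColors_spec (hφ : ∀ e, 1 ≤ φ e ∧ φ e ≤ k) (hD : D ≤ k) (hk : 0 < k) :
    ∃ s, selectColors D k (items ends φ) =
        List.ofFn (fun e => if D < rotateBy k s (φ e) then 0 else rotateBy k s (φ e)) ∧
      D * m ≤ k * {e | rotateBy k s (φ e) ≤ D}.ncard := by
  have hmem : ∃ s, selectColors D k (items ends φ) = window D k s (items ends φ) := by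
    rcases pick_mem (fun s t => decide (numColored s < numColored t))
      ((List.range k).map fun s => window D k s (items ends φ)) (window D k 0 (items ends φ))
      with h | h
    · exact ⟨0, h⟩
    · obtain ⟨s, -, hs⟩ := List.mem_map.1 h
      exact ⟨s, hs.symm⟩
  obtain ⟨s, hs⟩ := hmem
  refine ⟨s, by rw [hs, window_items], ?_⟩
  obtain ⟨s', hs', h⟩ := exists_window hφ hD hk
  refine h.trans (Nat.mul_le_mul_left _ ?_)
  have hmax := (pick_max numColored ((List.range k).map fun s => window D k s (items ends φ))
    (window D k 0 (items ends φ))).2 _ (List.mem_map.2 ⟨s', List.mem_range.2 hs', rfl⟩)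
  rw [← selectColors, hs, numColored_window hφ, numColored_window hφ] at hmax
  exact hmax

end Windows

/-! ### Fat triangles in graphs -/

section Bottleneck

variable {α β : Type*} {G : Graph α β}

theorem contains_ofEnds {α' β' : Type*} {κ : β' → Sym2 α'} {F : α' → α}
    (hF : Function.Injective F) (hV : ∀ a, F a ∈ V(G)) {g : β' → β} (hg : Function.Injective g)
    (hlink : ∀ e u v, κ e = s(u, v) → G.IsLink (g e) (F u) (F v)) : Contains G (ofEnds κ) := by
  have hE : ∀ e, g e ∈ E(G) := by
    intro e
    induction h : κ e with
    | _ u v => exact (hlink e u v h).edge_mem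
  exact ⟨⟨fun a => ⟨F a, hV a⟩, fun a b h => Subtype.ext (hF (congrArg Subtype.val h))⟩,
    ⟨fun e => ⟨g e, hE e⟩, fun e f h => Subtype.ext (hg (congrArg Subtype.val h))⟩,
    fun e x y h => hlink e x y h⟩

theorem exists_injective_of_le_ncard {E : Type*} [Finite E] {S : Set E} {d : ℕ}
    (h : d ≤ S.ncard) : ∃ g : Fin d → E, Function.Injective g ∧ ∀ j, g j ∈ S := by
  classical
  have := Fintype.ofFinite E
  obtain ⟨g⟩ := Function.Embedding.nonempty_of_card_le (α := Fin d) (β := S) (by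
    rwa [Fintype.card_fin, ← Nat.card_eq_fintype_card, Nat.card_coe_set_eq])
  exact ⟨fun j => g j, fun i j h => g.injective (Subtype.ext h), fun j => (g j).2⟩

variable {n m d ε : ℕ} {ends : Fin m → Fin n × Fin n} {vtx : Fin n → α} {edg : Fin m → β}

theorem FatTriangle.hasBottleneck (hF : FatTriangle (symEnds ends) d ε) (hε : ε ≤ 1)
    (hvtx : Function.Injective vtx) (hV : ∀ v, vtx v ∈ V(G)) (hedg : Function.Injective edg)
    (hlink : ∀ e, G.IsLink (edg e) (vtx (ends e).1) (vtx (ends e).2)) :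
    HasBottleneck G (2 * d + ε) := by
  obtain ⟨x, y, z, hxy, hyz, hxz, mxy, myz, mxz⟩ := hF
  have hlink' : ∀ e u v, symEnds ends e = s(u, v) → G.IsLink (edg e) (vtx u) (vtx v) := by
    intro e u v h
    rw [symEnds, Sym2.eq_iff] at h
    rcases h with ⟨rfl, rfl⟩ | ⟨rfl, rfl⟩
    · exact hlink e
    · exact (hlink e).symm
  let p : Fin 3 → Fin n := ![x, y, z]
  have hp : Function.Injective p := by
    intro i j h
    fin_cases i <;> fin_cases j <;> simp_all [p]
  have hm : ∀ i : Fin 3, d ≤ {e | symEnds ends e = s(p i, p (i + 1))}.ncard := by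
    intro i
    fin_cases i
    · exact (Nat.le_add_right _ _).trans mxy
    · exact myz
    · rw [mult_comm] at mxz
      exact mxz
  choose g hginj hgS using fun i => exists_injective_of_le_ncard (hm i)
  have hgS' : ∀ i j, symEnds ends (g i j) = s(p i, p (i + 1)) := hgS
  -- The three sides of the triangle are different pairs, so edges chosen for different sides are
  -- distinct.
  have hpair : ∀ i i' : Fin 3, s(p i, p (i + 1)) = s(p i', p (i' + 1)) → i = i' := by
    have hdec : ∀ i i' : Fin 3, s(i, i + 1) = s(i', i' + 1) → i = i' := by decide
    exact fun i i' h => hdec i i' (Sym2.map.injective hp (by simpa using h))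
  have hg : Function.Injective fun e : Fin 3 × Fin d => g e.1 e.2 := by
    rintro ⟨i, j⟩ ⟨i', j'⟩ h
    simp only at h
    have hi : i = i' := hpair i i' (by rw [← hgS' i j, ← hgS' i' j', h])
    subst hi
    rw [hginj i h]
  have hF : Function.Injective fun i => vtx (p i) := hvtx.comp hp
  rcases Nat.le_one_iff_eq_zero_or_eq_one.1 hε with rfl | rfl
  · refine Or.inl ⟨⟨d, by omega⟩, ?_⟩
    rw [show (2 * d + 0) / 2 = d by omega]
    refine contains_ofEnds hF (fun _ => hV _) (hedg.comp hg) ?_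
    intro e u v h
    refine hlink' _ _ _ ?_
    rw [hgS']
    simpa using congrArg (Sym2.map p) h
  · refine Or.inr ⟨⟨d, rfl⟩, ?_⟩
    rw [show (2 * d + 1 - 1) / 2 = d by omega]
    -- Between `x` and `y` there are at least d + 1 edges and only d are in use; another one serves
    -- as the additional edge.
    have hex : ∃ e ∈ {e | symEnds ends e = s(p 0, p 1)}, e ∉ Set.range (g 0) := by
      refine Set.exists_mem_notMem_of_ncard_lt_ncard ?_ (Set.toFinite _)
      rw [← Set.image_univ, Set.ncard_image_of_injective _ (hginj 0), Set.ncard_univ,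
        Nat.card_eq_fintype_card, Fintype.card_fin]
      exact mxy
    obtain ⟨e₀, he₀, hn₀⟩ := hex
    have he₀' : symEnds ends e₀ = s(p 0, p (0 + 1)) := he₀
    have hne : ∀ e : Fin 3 × Fin d, g e.1 e.2 ≠ e₀ := by
      rintro ⟨i, j⟩ h
      have hi : i = 0 := hpair i 0 (by rw [← hgS' i j, ← he₀', h])
      subst hi
      exact hn₀ ⟨j, h⟩
    have hg' : Function.Injective fun e : Option (Fin 3 × Fin d) =>
        e.elim e₀ fun e => g e.1 e.2 := by
      rintro (_ | e) (_ | e') h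
      · rfl
      · exact absurd h.symm (hne e')
      · exact absurd h (hne e)
      · rw [hg h]
    refine contains_ofEnds hF (fun _ => hV _) (hedg.comp hg') ?_
    intro e u v h
    refine hlink' _ _ _ ?_
    rcases e with _ | e
    · refine he₀'.trans ?_
      simpa using congrArg (Sym2.map p) h
    · refine (hgS' _ _).trans ?_
      simpa using congrArg (Sym2.map p) h

theorem setting_of_hasMaxDegree {Δ : ℕ} (hE : E(G).Finite) (hloop : G.Loopless)
    (hmax : HasMaxDegree G Δ) (hΔ : 4 ≤ Δ) (hV : ∀ v, vtx v ∈ V(G))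
    (hedg : Function.Injective edg)
    (hlink : ∀ e, G.IsLink (edg e) (vtx (ends e).1) (vtx (ends e).2)) :
    Setting (symEnds ends) (Δ + Δ / 2 - 1) (Δ / 2) (Δ % 2) := by
  refine ⟨fun e v h => ?_, fun v => ?_, by omega, by omega, by omega⟩
  · rw [symEnds, Sym2.eq_iff] at h
    have := hlink e
    rcases h with ⟨h1, h2⟩ | ⟨h1, h2⟩ <;>
    · rw [h1, h2] at this
      exact hloop.not_isLoopAt _ _ this
  · have h1 : degree G (vtx v) ≤ Δ := hmax.2 ⟨_, hV v, rfl⟩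
    have h2 : {e | v ∈ symEnds ends e}.ncard ≤ degree G (vtx v) := by
      rw [← Set.ncard_image_of_injective _ hedg]
      refine Set.ncard_le_ncard ?_ (hE.subset (G.incidenceSet_subset_edgeSet _))
      rintro _ ⟨e, he, rfl⟩
      rcases Sym2.mem_iff.1 he with rfl | rfl
      · exact (hlink e).inc_left
      · exact (hlink e).inc_right
    omega

theorem ratio_mul_le {Δ q m : ℕ} (hΔ : 4 ≤ Δ) (h : Δ * m ≤ (Δ + Δ / 2 - 1) * q) :
    ratio Δ * (m : ℚ) ≤ q := by
  have hfl : ⌊(3 / 2 : ℚ) * Δ⌋ = ((Δ + Δ / 2 : ℕ) : ℤ) := by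
    rw [Int.floor_eq_iff]
    have h1 : (2 : ℚ) * (Δ / 2 : ℕ) + (Δ % 2 : ℕ) = Δ := by exact_mod_cast Nat.div_add_mod Δ 2
    have h2 : ((Δ % 2 : ℕ) : ℚ) ≤ 1 := by exact_mod_cast (by omega : Δ % 2 ≤ 1)
    have h3 : (0 : ℚ) ≤ ((Δ % 2 : ℕ) : ℚ) := Nat.cast_nonneg _
    rw [Int.cast_natCast, Nat.cast_add]
    constructor <;> linarith
  have hk : ((⌊(3 / 2 : ℚ) * Δ⌋ : ℚ) - 1) = ((Δ + Δ / 2 - 1 : ℕ) : ℚ) := by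
    rw [hfl, Nat.cast_sub (by omega)]
    push_cast
    rfl
  have hpos : (0 : ℚ) < ((Δ + Δ / 2 - 1 : ℕ) : ℚ) := by exact_mod_cast (by omega)
  rw [ratio, hk, div_mul_eq_mul_div, div_le_iff₀ hpos, mul_comm (q : ℚ)]
  exact_mod_cast h

theorem numColors_eq (D : ℕ) : numColors D = D + D / 2 - 1 := by
  have h : ((List.range D).filter fun j => decide (j + j + 1 < D)).length = D / 2 := by
    have h1 := Nat.count_eq_card_filter_range (fun j => j + j + 1 < D) D
    rw [Nat.count, List.countP_eq_length_filter] at h1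
    rw [h1]
    have h2 : (Finset.range D).filter (fun j => j + j + 1 < D) = Finset.range (D / 2) := by
      ext j
      rw [Finset.mem_filter, Finset.mem_range, Finset.mem_range]
      omega
    rw [h2, Finset.card_range]
  rw [numColors, h]

end Bottleneck

/-! ### Assembly of the existence statement and the algorithm -/

section Main

variable {n m k D : ℕ} {ends : Fin m → Fin n × Fin n}

theorem inputGraph_inc {e : Fin m} {v : Fin n} :
    (inputGraph ends).Inc e v ↔ v ∈ symEnds ends e :=
  ⟨fun ⟨w, hw⟩ => ⟨w, hw⟩, fun ⟨w, hw⟩ => ⟨w, hw⟩⟩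

theorem maxDeg_eq {Δ : ℕ} (hmax : HasMaxDegree (inputGraph ends) Δ) :
    maxDeg n (List.ofFn fun e => (((ends e).1 : ℕ), ((ends e).2 : ℕ))) = Δ := by
  set es := List.ofFn fun e => (((ends e).1 : ℕ), ((ends e).2 : ℕ)) with hes
  have hdeg : ∀ v : Fin n, (es.filter fun p => p.1 == (v : ℕ) || p.2 == (v : ℕ)).length =
      degree (inputGraph ends) v := by
    intro v
    rw [hes, length_filter_ofFn, degree]
    congr 1
    ext e
    rw [Graph.mem_incidenceSet, inputGraph_inc, symEnds, Sym2.mem_iff]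
    simp only [Bool.or_eq_true, beq_iff_eq, Fin.val_inj, Set.mem_ofPred_eq]
    exact or_congr eq_comm eq_comm
  refine le_antisymm ?_ ?_
  · rcases pick_mem (fun s t => decide (s < t)) ((List.range n).map fun v =>
      (es.filter fun p => p.1 == v || p.2 == v).length) 0 with h | h
    · rw [maxDeg, h]
      exact Nat.zero_le _
    · obtain ⟨v, hv, hv'⟩ := List.mem_map.1 h
      rw [List.mem_range] at hv
      rw [maxDeg, ← hv', hdeg ⟨v, hv⟩]
      exact hmax.2 ⟨_, Set.mem_univ _, rfl⟩
  · obtain ⟨v, -, hv⟩ := hmax.1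
    rw [← hv, ← hdeg]
    exact (pick_max (fun s => s) _ 0).2 _ (List.mem_map.2 ⟨v, List.mem_range.2 v.2, rfl⟩)

theorem enc_input (ends : Fin m → Fin n × Fin n) :
    Enc.enc (n, List.ofFn fun e => (((ends e).1 : ℕ), ((ends e).2 : ℕ))) = encodeInput ends := by
  rw [enc_pair, encodeInput]
  congr 1
  exact congrArg encodeList (by rw [List.map_ofFn]; rfl)

theorem esize_input_le (ends : Fin m → Fin n × Fin n) :
    esize (n, List.ofFn fun e => (((ends e).1 : ℕ), ((ends e).2 : ℕ))) ≤
      (n + m) * (4 * (n + m) + 4) + 2 * (n + m) + 3 := by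
  have h := esize_le_of_forall (l := List.ofFn fun e => (((ends e).1 : ℕ), ((ends e).2 : ℕ)))
    (B := 4 * (n + m) + 3) fun t ht => by
      obtain ⟨e, rfl⟩ := List.mem_ofFn.1 ht
      rw [esize_pair, esize_nat, esize_nat]
      omega
  rw [List.length_ofFn, add_assoc (4 * (n + m)) 3 1, show 3 + 1 = 4 from rfl] at h
  have h2 := Nat.mul_le_mul_right (4 * (n + m) + 4) (show m ≤ n + m by omega)
  rw [esize_pair, esize_nat]
  omega

/-- The partial colouring given by a cyclic window of colours. -/
def windowColoring (D : ℕ) (r : Fin m → ℕ) (hr : ∀ e, 1 ≤ r e) (e : Fin m) : Option (Fin D) :=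
  if h : r e ≤ D then some ⟨r e - 1, by have := hr e; omega⟩ else none

theorem windowColoring_ne_none {r : Fin m → ℕ} {hr : ∀ e, 1 ≤ r e} {e : Fin m} :
    windowColoring D r hr e ≠ none ↔ r e ≤ D := by
  unfold windowColoring
  split_ifs with h <;> simp [h]

theorem eq_of_windowColoring_eq {r : Fin m → ℕ} {hr : ∀ e, 1 ≤ r e} {e f : Fin m}
    (he : windowColoring D r hr e ≠ none)
    (h : windowColoring D r hr e = windowColoring D r hr f) : r e = r f := by
  have hf : windowColoring D r hr f ≠ none := h ▸ he
  rw [windowColoring_ne_none] at he hf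
  unfold windowColoring at h
  rw [dif_pos he, dif_pos hf, Option.some_inj, Fin.mk.injEq] at h
  have := hr e
  have := hr f
  omega

theorem encodeOutput_windowColoring {r : Fin m → ℕ} (hr : ∀ e, 1 ≤ r e) :
    encodeOutput (windowColoring D r hr) =
      Enc.enc (List.ofFn fun e => if D < r e then 0 else r e) := by
  refine congrArg encodeList ?_
  rw [List.map_ofFn]
  refine congrArg List.ofFn (funext fun e => congrArg encodeNat ?_)
  have := hr e
  simp only [windowColoring]
  by_cases h : r e ≤ D
  · rw [dif_pos h, if_neg (by omega)]
    simp only [Option.elim_some]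
    omega
  · rw [dif_neg h, if_pos (by omega), Option.elim_none]

theorem Proper.ne_rotateBy {φ : Fin m → ℕ} (hp : Proper (symEnds ends) φ)
    (hφ : ∀ e, 1 ≤ φ e ∧ φ e ≤ k) {e f : Fin m} {v : Fin n} (hne : e ≠ f) (he : v ∈ symEnds ends e)
    (hf : v ∈ symEnds ends f) (s : ℕ) : rotateBy k s (φ e) ≠ rotateBy k s (φ f) := by
  intro h
  have h1 := (hφ e).1
  exact hp e f v hne he hf (by omega) (rotateBy_inj (hφ e).1 (hφ e).2 (hφ f).1 (hφ f).2 h)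

/-- After numbering vertices and edges, `colorAll_spec` serves as a pure existence proof of a
`k`-edge-coloring; the subgraph consists of the edges in the best window. -/
theorem exists_colorable_subgraph {α β : Type*} (G : Graph α β) (Δ : ℕ) (hV : V(G).Finite)
    (hE : E(G).Finite) (hloop : G.Loopless) (hmax : HasMaxDegree G Δ) (hΔ : 4 ≤ Δ)
    (hG : ¬ HasBottleneck G Δ) :
    ∃ H : Graph α β, H ≤ G ∧ EdgeColorable H Δ ∧
      ratio Δ * (E(G).ncard : ℚ) ≤ (E(H).ncard : ℚ) := by
  have := hV.to_subtype
  have := hE.to_subtype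
  obtain ⟨n, ⟨iV⟩⟩ := Finite.exists_equiv_fin V(G)
  obtain ⟨m, ⟨iE⟩⟩ := Finite.exists_equiv_fin E(G)
  let vtx : Fin n → α := fun v => iV.symm v
  let edg : Fin m → β := fun e => iE.symm e
  have hvtx : Function.Injective vtx := Subtype.val_injective.comp iV.symm.injective
  have hedg : Function.Injective edg := Subtype.val_injective.comp iE.symm.injective
  have hvV : ∀ v, vtx v ∈ V(G) := fun v => (iV.symm v).2
  have hex : ∀ e : Fin m, ∃ p : Fin n × Fin n, G.IsLink (edg e) (vtx p.1) (vtx p.2) := by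
    intro e
    obtain ⟨x, y, h⟩ := G.exists_isLink_of_mem_edgeSet (iE.symm e).2
    exact ⟨(iV ⟨x, h.left_mem⟩, iV ⟨y, h.right_mem⟩), by simpa [vtx] using h⟩
  choose ends hlink using hex
  have hsurj : ∀ b ∈ E(G), ∃ e, edg e = b := fun b hb => ⟨iE ⟨b, hb⟩, by simp [edg]⟩
  have hinc : ∀ e v, G.Inc (edg e) v → ∃ u, vtx u = v ∧ u ∈ symEnds ends e := by
    intro e v h
    rcases h.eq_or_eq_of_isLink (hlink e) with rfl | rfl
    · exact ⟨_, rfl, by simp [symEnds]⟩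
    · exact ⟨_, rfl, by simp [symEnds]⟩
  have hS := setting_of_hasMaxDegree hE hloop hmax hΔ hvV hedg hlink
  have hF : ¬ FatTriangle (symEnds ends) (Δ / 2) (Δ % 2) := by
    intro hF
    have := hF.hasBottleneck (by omega) hvtx hvV hedg hlink
    rw [Nat.div_add_mod] at this
    exact hG this
  set k := Δ + Δ / 2 - 1
  obtain ⟨φ, -, hp, hφ⟩ := colorAll_spec hS hF
  obtain ⟨s, -, hs⟩ := exists_window (D := Δ) hφ (by omega) (by omega)
  have hr : ∀ e, 1 ≤ rotateBy k s (φ e) := fun e => one_le_rotateBy (hφ e).1 (hφ e).2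
  let F : Set β := edg '' {e | rotateBy k s (φ e) ≤ Δ}
  have hFE : F ⊆ E(G) := by
    rintro _ ⟨e, -, rfl⟩
    exact (iE.symm e).2
  have hEH : E(G.restrict F) = F := by
    rw [Graph.edgeSet_restrict]
    exact Set.inter_eq_self_of_subset_right hFE
  have hmem : ∀ b : E(G.restrict F), ∃ e, rotateBy k s (φ e) ≤ Δ ∧ edg e = b := by
    rintro ⟨b, hb⟩
    rw [hEH] at hb
    exact hb
  choose g hg1 hg2 using hmem
  refine ⟨G.restrict F, Graph.restrict_le, ⟨fun b => ⟨rotateBy k s (φ (g b)) - 1, ?_⟩, ?_⟩, ?_⟩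
  · have := hr (g b)
    have := hg1 b
    omega
  · intro b b' v hne hb hb' heq
    rw [Fin.mk.injEq] at heq
    have h1 := hr (g b)
    have h2 := hr (g b')
    rw [← hg2, Graph.restrict_inc] at hb hb'
    obtain ⟨u, rfl, hu⟩ := hinc _ _ hb.1
    obtain ⟨u', hu', hu''⟩ := hinc _ _ hb'.1
    obtain rfl := hvtx hu'
    refine hp.ne_rotateBy hφ (e := g b) (f := g b') ?_ hu hu'' s (by omega)
    intro h
    exact hne (Subtype.ext (by rw [← hg2 b, ← hg2 b', h]))
  · have hm : E(G).ncard = m := by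
      rw [← Nat.card_coe_set_eq, Nat.card_congr iE, Nat.card_eq_fintype_card, Fintype.card_fin]
    rw [hm, hEH, Set.ncard_image_of_injective _ hedg]
    exact ratio_mul_le hΔ hs

theorem algorithm_spec {Δ : ℕ} (ends : Fin m → Fin n × Fin n) (hΔ : 4 ≤ Δ)
    (hloop : (inputGraph ends).Loopless) (hmax : HasMaxDegree (inputGraph ends) Δ)
    (hG : ¬ HasBottleneck (inputGraph ends) Δ) :
    ∃ π : Fin m → Option (Fin Δ),
      Enc.enc (algorithm (n, List.ofFn fun e => (((ends e).1 : ℕ), ((ends e).2 : ℕ)))) =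
        encodeOutput π ∧ IsPartialColoring (inputGraph ends) π ∧
      ratio Δ * (m : ℚ) ≤ ({e : Fin m | π e ≠ none}.ncard : ℚ) := by
  have hlink : ∀ e, (inputGraph ends).IsLink (id e) (id (ends e).1) (id (ends e).2) :=
    fun e => rfl
  have hS := setting_of_hasMaxDegree (Set.toFinite _) hloop hmax hΔ (fun _ => Set.mem_univ _)
    Function.injective_id hlink
  have hF : ¬ FatTriangle (symEnds ends) (Δ / 2) (Δ % 2) := by
    intro hF
    have := hF.hasBottleneck (by omega) Function.injective_id (fun _ => Set.mem_univ _)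
      Function.injective_id hlink
    rw [Nat.div_add_mod] at this
    exact hG this
  rw [← numColors_eq] at hS
  have hk := numColors_eq Δ
  obtain ⟨φ, hφ, hp, hφk⟩ := colorAll_spec hS hF
  obtain ⟨s, hs, hcard⟩ := selectColors_spec (D := Δ) (ends := ends) hφk (by omega) (by omega)
  have hr : ∀ e, 1 ≤ rotateBy (numColors Δ) s (φ e) :=
    fun e => one_le_rotateBy (hφk e).1 (hφk e).2
  refine ⟨windowColoring Δ (fun e => rotateBy (numColors Δ) s (φ e)) hr, ?_, ?_, ?_⟩
  · rw [encodeOutput_windowColoring, algorithm]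
    simp only
    rw [maxDeg_eq hmax, solve, hφ, hs]
  · intro e f v hne he hf h0 heq
    exact hp.ne_rotateBy hφk hne (inputGraph_inc.1 he) (inputGraph_inc.1 hf) s
      (eq_of_windowColoring_eq h0 heq)
  · simp only [windowColoring_ne_none]
    refine ratio_mul_le hΔ ?_
    rwa [← hk]

end Main

end MaxECS

theorem theorem1 :
    (∀ (α β : Type*) (G : Graph α β) (Δ : ℕ),
      V(G).Finite → E(G).Finite → G.Loopless → MaxECS.HasMaxDegree G Δ → 4 ≤ Δ →
      ¬ MaxECS.HasBottleneck G Δ →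
      ∃ H : Graph α β, H ≤ G ∧ MaxECS.EdgeColorable H Δ ∧
        MaxECS.ratio Δ * (E(G).ncard : ℚ) ≤ (E(H).ncard : ℚ)) ∧
    (∃ P : MaxECS.Prog, ∀ Δ : ℕ, 4 ≤ Δ → ∃ p : Polynomial ℕ,
      ∀ (n m : ℕ) (ends : Fin m → Fin n × Fin n),
        (MaxECS.inputGraph ends).Loopless →
        MaxECS.HasMaxDegree (MaxECS.inputGraph ends) Δ →
        ¬ MaxECS.HasBottleneck (MaxECS.inputGraph ends) Δ →
        ∃ (π : Fin m → Option (Fin Δ)) (t : ℕ),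
          MaxECS.Run P (MaxECS.encodeInput ends) (MaxECS.encodeOutput π) t ∧
          t ≤ p.eval (n + m) ∧
          MaxECS.IsPartialColoring (MaxECS.inputGraph ends) π ∧
          MaxECS.ratio Δ * (m : ℚ) ≤ ({e : Fin m | π e ≠ none}.ncard : ℚ)) := by
  refine ⟨fun α β G Δ hV hE hloop hmax hΔ hG =>
    MaxECS.exists_colorable_subgraph G Δ hV hE hloop hmax hΔ hG, ?_⟩
  obtain ⟨P, T, B, hP⟩ := MaxECS.PT.algorithm
  -- The time bound is composed with the bound of `esize_input_le` on the input size. It does not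
  -- depend on `Δ`, since the program computes the maximum degree itself.
  refine ⟨P, fun Δ hΔ => ⟨T.comp (.X * (4 * .X + 4) + 2 * .X + 3), ?_⟩⟩
  intro n m ends hloop hmax hG
  obtain ⟨π, h1, h2, h3⟩ := MaxECS.algorithm_spec ends hΔ hloop hmax hG
  obtain ⟨⟨t, ht, hr⟩, -⟩ := hP (n, List.ofFn fun e => (((ends e).1 : ℕ), ((ends e).2 : ℕ)))
  rw [h1, MaxECS.enc_input] at hr
  refine ⟨π, t, hr, ht.trans ?_, h2, h3⟩
  rw [Polynomial.eval_comp]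
  refine MaxECS.eval_mono _ ((MaxECS.esize_input_le ends).trans (le_of_eq ?_))
  simp
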